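/- Let $p\in L_\infty[0,1]$ be real and uniformly positive ($p\ge m$ a.e. for some $m>0$). Let $W_2^1[0,1]$ be the complex Sobolev space with norm $\|y\|^2=\int_0^1(|y'|^2+|y|^2)\,dx$, and $W_2^{-1}[0,1]$ its dual, the value of $f\in W_2^{-1}[0,1]$ at $z\in W_2^1[0,1]$ being written $\int_0^1 f z\,dx$. Let $r\in W_2^{-1}[0,1]$ be nonnegative (i.e. $\int_0^1 r z\,dx\ge 0$ for every nonnegative $z\in W_2^1[0,1]$) with support $[0,1]$. Let $U$ be a diagonal unitary complex $2\times2$ matrix, and write $y^\wedge=(y(0),y(1))^T$, $y^\vee=(y^{[1]}(0),-y^{[1]}(1))^T$. Put $\mathfrak H_U=\{y\in W_2^1[0,1] : y^\wedge\in\operatorname{im}(U-1)\}$ with the norm of $W_2^1[0,1]$, let $I:\mathfrak H_U\to L_2[0,1]$ be the embedding, $\mathfrak H_U'$ the completion of $L_2[0,1]$ in the norm $\|I^*y\|_{\mathfrak H_U}$, and $I^+:\mathfrak H_U'\to\mathfrak H_U$ the isometric extension of $I^*$. Let $V$ be the diagonal matrix with $V_{kk}=-\cot\frac{\arg U_{kk}}2$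 if $U_{kk}\ne1$ and $V_{kk}=0$ if $U_{kk}=1$. Let $T(\lambda):\mathfrak H_U\to\mathfrak H_U'$, $\lambda\in\mathbb C$, be the linear pencil of bounded operators defined (with potential $q=0$) by $$\langle I^+T(\lambda)y,y\rangle_{\mathfrak H_U}=\int_0^1 p|y'|^2\,dx-\lambda\int_0^1 r|y|^2\,dx+\langle Vy^\wedge,y^\wedge\rangle_{\mathbb C^2},\qquad y\in\mathfrak H_U .$$ It corresponds to $-(py')'-\lambda ry=0$ with boundary conditions $(U-1)y^\vee+i(U+1)y^\wedge=0$. Assume that, as linear conditions on the boundary values $y(0),y(1),y^{[1]}(0),y^{[1]}(1)$, these boundary conditions are equivalent to one of the following: 1. $y(0)=y(1)=0$; 2. $y^{[1]}(0)=y(1)=0$; 3. $y^{[1]}(0)=y^{[1]}(1)+C\,y(1)=0$ for some real $C>0$. Then $T(0)$ is boundedly invertible, and the operator $R=[T(0)]^{-1}\cdot\frac{dT}{d\lambda}:\mathfrak H_U\to\mathfrak H_U$ is strongly sign-regular, that is: $R$ maps real functions to real functions, and for every natural number $n$ and every real $y\in\mathfrak H_U$ such that $Ry$ has at least $n$ pseudo-zeros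 on $(0,1)$, the function $y$ has at least $n$ sign changes on $(0,1)$. Here a real continuous function $f$ on $[0,1]$ has at least $n$ sign changes on $(0,1)$ if there are points $0<x_1<\dots<x_{n+1}<1$ with $f(x_k)f(x_{k+1})<0$ for $k=1,\dots,n$; it has at least $n$ pseudo-zeros on $(0,1)$ if there are $\varepsilon>0$ and points $0<x_1<\dots<x_{n+1}<1$ such that $|f(x_k)|>\varepsilon$ for $k=1,\dots,n+1$ and for each $k=1,\dots,n$ there is $t\in(x_k,x_{k+1})$ with $|f(t)|<\varepsilon$. -/

import Mathlib

open MeasureTheory Set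
open scoped unitInterval ComplexConjugate

noncomputable section

namespace SturmLiouville

/-- The complex Hilbert space `L_2[0,1]`. -/
abbrev L2 : Type := Lp ℂ 2 (volume : Measure I)

/-- The real Banach space `L_∞[0,1]`. -/
abbrev LInf : Type := Lp ℝ ⊤ (volume : Measure I)

/-! ### The Sobolev space `W_2^1[0,1]` -/

/-- Pairs `(y, y')` where `y` is an absolutely continuous function on `[0,1]` whose derivative
`y'` belongs to `L_2[0,1]`; the second component is determined by the first one. -/
def sobolevGraph : Submodule ℂ (C(I, ℂ) × L2) where
  carrier := {w | ∀ x : I, w.1 x = w.1 0 + ∫ t in Icc 0 x, w.2 t}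
  zero_mem' := by
    intro x
    have h : ∀ᵐ t ∂(volume.restrict (Icc 0 x)), ((0 : L2) : I → ℂ) t = 0 :=
      ae_restrict_of_ae (Lp.coeFn_zero ℂ 2 volume)
    simp only [Prod.fst_zero, Prod.snd_zero, ContinuousMap.zero_apply, integral_congr_ae h,
      integral_zero, add_zero]
  add_mem' := by
    intro v w hv hw x
    have h : ∀ᵐ t ∂(volume.restrict (Icc 0 x)), (v.2 + w.2 : L2) t = v.2 t + w.2 t :=
      ae_restrict_of_ae (Lp.coeFn_add v.2 w.2)
    have hi : ∀ g : L2, Integrable g (volume.restrict (Icc 0 x)) := fun g =>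
      ((Lp.memLp g).integrable (by norm_num)).restrict
    simp only [Prod.fst_add, Prod.snd_add, ContinuousMap.add_apply, integral_congr_ae h]
    rw [integral_add (hi _) (hi _), hv x, hw x]
    ring
  smul_mem' := by
    intro c w hw x
    have h : ∀ᵐ t ∂(volume.restrict (Icc 0 x)), (c • w.2 : L2) t = c * w.2 t :=
      ae_restrict_of_ae (Lp.coeFn_smul c w.2)
    simp only [Prod.smul_fst, Prod.smul_snd, ContinuousMap.smul_apply, integral_congr_ae h,
      smul_eq_mul]
    rw [integral_const_mul, hw x]
    ring

namespace sobolevGraph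

theorem norm_integral_le (g : L2) (x : I) : ‖∫ t in Icc 0 x, g t‖ ≤ ‖g‖ := by
  have hx : (volume : Measure I) (Icc 0 x) ≠ ⊤ := measure_ne_top _ _
  rw [← L2.inner_indicatorConstLp_one (𝕜 := ℂ) measurableSet_Icc hx g]
  refine (norm_inner_le_norm _ _).trans (mul_le_of_le_one_left (norm_nonneg _) ?_)
  refine norm_indicatorConstLp_le.trans ?_
  rw [norm_one, one_mul]
  exact Real.rpow_le_one measureReal_nonneg measureReal_le_one (by norm_num)

theorem norm_apply_le (y : sobolevGraph) (x : I) :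
    ‖y.1.1 x‖ ≤ ‖(ContinuousMap.toLp 2 volume ℂ y.1.1 : L2)‖ + 2 * ‖y.1.2‖ := by
  have h1 : ∀ t : I, ‖y.1.1 x‖ - 2 * ‖y.1.2‖ ≤ ‖y.1.1 t‖ := by
    intro t
    have hx := y.2 x
    have ht := y.2 t
    have h : y.1.1 x = y.1.1 t + (∫ s in Icc 0 x, y.1.2 s) - ∫ s in Icc 0 t, y.1.2 s := by
      rw [hx, ht]; ring
    have h2 := norm_integral_le y.1.2 x
    have h3 := norm_integral_le y.1.2 t
    have h4 := norm_sub_le (y.1.1 t + ∫ s in Icc 0 x, y.1.2 s) (∫ s in Icc 0 t, y.1.2 s)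
    have h5 := norm_add_le (y.1.1 t) (∫ s in Icc 0 x, y.1.2 s)
    rw [← h] at h4
    linarith
  by_cases hc : 0 ≤ ‖y.1.1 x‖ - 2 * ‖y.1.2‖
  · have h2 : ‖Lp.const 2 (volume : Measure I) ((‖y.1.1 x‖ - 2 * ‖y.1.2‖ : ℝ))‖ ≤
        ‖(ContinuousMap.toLp 2 volume ℂ y.1.1 : L2)‖ := by
      refine Lp.norm_le_norm_of_ae_le ?_
      filter_upwards [Lp.coeFn_const (p := 2) (μ := (volume : Measure I))
        (‖y.1.1 x‖ - 2 * ‖y.1.2‖ : ℝ), ContinuousMap.coeFn_toLp (p := 2) (𝕜 := ℂ)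
        (volume : Measure I) y.1.1] with t ht ht'
      rw [ht, ht']
      simpa [abs_of_nonneg hc] using h1 t
    rw [Lp.norm_const _ _ _ (by norm_num)] at h2
    simp only [Real.norm_eq_abs, abs_of_nonneg hc, probReal_univ, Real.one_rpow, mul_one] at h2
    linarith
  · have := norm_nonneg (ContinuousMap.toLp 2 volume ℂ y.1.1 : L2)
    linarith

/-- The inner product `∫ (y' z̄' + y z̄) dx`; in Mathlib's convention `inner ℂ z y` is linear
in `y`. -/
@[reducible] def core : InnerProductSpace.Core ℂ sobolevGraph where
  inner y z := inner ℂ y.1.2 z.1.2 +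
    inner ℂ (ContinuousMap.toLp 2 volume ℂ y.1.1 : L2) (ContinuousMap.toLp 2 volume ℂ z.1.1)
  conj_inner_symm y z := by simp only [map_add, inner_conj_symm]
  re_inner_nonneg y := by
    rw [map_add]
    exact add_nonneg inner_self_nonneg inner_self_nonneg
  add_left x y z := by
    simp only [Submodule.coe_add, Prod.fst_add, Prod.snd_add, map_add, inner_add_left]; ring
  smul_left x y c := by
    simp only [Submodule.coe_smul, Prod.smul_fst, Prod.smul_snd, map_smul, inner_smul_left]; ring
  definite y h := by
    have h1 := congrArg RCLike.re h
    rw [map_add, map_zero, inner_self_eq_norm_sq, inner_self_eq_norm_sq] at h1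
    have h2 : ‖y.1.2‖ = 0 := by
      nlinarith [norm_nonneg y.1.2, norm_nonneg (ContinuousMap.toLp 2 volume ℂ y.1.1 : L2)]
    have h3 : ‖(ContinuousMap.toLp 2 volume ℂ y.1.1 : L2)‖ = 0 := by
      nlinarith [norm_nonneg y.1.2, norm_nonneg (ContinuousMap.toLp 2 volume ℂ y.1.1 : L2)]
    refine Subtype.ext (Prod.ext ?_ (norm_eq_zero.1 h2))
    ext x
    have h4 := norm_apply_le y x
    rw [h2, h3, mul_zero, add_zero] at h4
    exact norm_le_zero_iff.1 h4

end sobolevGraph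

/-- The Sobolev space `W_2^1[0,1]` of complex functions, with its usual Hilbert space
structure. -/
def W21 : Type := sobolevGraph

namespace W21

instance : NormedAddCommGroup W21 :=
  @InnerProductSpace.Core.toNormedAddCommGroup ℂ sobolevGraph _ _ _ sobolevGraph.core

instance : InnerProductSpace ℂ W21 := InnerProductSpace.ofCore sobolevGraph.core.toCore

instance : Inner ℂ W21 := InnerProductSpace.toInner

/-- A Sobolev function as a continuous function on `[0,1]`. -/
def toC : W21 →ₗ[ℂ] C(I, ℂ) where
  toFun y := y.1.1
  map_add' _ _ := rfl
  map_smul' _ _ := rfl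

instance : CoeFun W21 (fun _ => I → ℂ) := ⟨fun y => toC y⟩

/-- The derivative `y'` of a Sobolev function. -/
def deriv : W21 →ₗ[ℂ] L2 where
  toFun y := y.1.2
  map_add' _ _ := rfl
  map_smul' _ _ := rfl

/-- The class in `L_2[0,1]` of a Sobolev function. -/
def toL2 : W21 →ₗ[ℂ] L2 := (ContinuousMap.toLp 2 volume ℂ).toLinearMap ∘ₗ toC

theorem eq_add_integral (y : W21) (x : I) : y x = y 0 + ∫ t in Icc 0 x, deriv y t := y.2 x

theorem ext {y z : W21} (h : toC y = toC z) (h' : deriv y = deriv z) : y = z :=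
  Subtype.ext (Prod.ext h h')

/-- The supremum norm is bounded by the Sobolev norm. -/
theorem norm_apply_le (y : W21) (x : I) : ‖y x‖ ≤ ‖toL2 y‖ + 2 * ‖deriv y‖ :=
  sobolevGraph.norm_apply_le y x

theorem inner_def (y z : W21) :
    inner ℂ y z = inner ℂ (deriv y) (deriv z) + inner ℂ (toL2 y) (toL2 z) := rfl

theorem norm_sq (y : W21) : ‖y‖ ^ 2 = ‖deriv y‖ ^ 2 + ‖toL2 y‖ ^ 2 := by
  rw [← inner_self_eq_norm_sq (𝕜 := ℂ), inner_def, map_add, inner_self_eq_norm_sq,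
    inner_self_eq_norm_sq]

theorem norm_deriv_le (y : W21) : ‖deriv y‖ ≤ ‖y‖ := by
  refine le_of_sq_le_sq ?_ (norm_nonneg _)
  rw [norm_sq]; nlinarith [sq_nonneg ‖toL2 y‖]

theorem norm_toL2_le (y : W21) : ‖toL2 y‖ ≤ ‖y‖ := by
  refine le_of_sq_le_sq ?_ (norm_nonneg _)
  rw [norm_sq]; nlinarith [sq_nonneg ‖deriv y‖]

theorem norm_toC_le (y : W21) : ‖toC y‖ ≤ 3 * ‖y‖ := by
  refine (ContinuousMap.norm_le _ (by positivity)).2 fun x => ?_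
  linarith [norm_apply_le y x, norm_deriv_le y, norm_toL2_le y]

theorem norm_toLp_le (f : C(I, ℂ)) : ‖(ContinuousMap.toLp 2 volume ℂ f : L2)‖ ≤ ‖f‖ := by
  have h := (ContinuousMap.toLp (E := ℂ) 2 (volume : Measure I) ℂ).le_of_opNorm_le
    (ContinuousMap.toLp_norm_le (p := 2) (E := ℂ) (𝕜 := ℂ) (volume : Measure I)) f
  refine h.trans (mul_le_of_le_one_left (norm_nonneg _) ?_)
  refine Real.rpow_le_one (NNReal.coe_nonneg _) ?_ (by norm_num)
  simp [measureUnivNNReal]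

def derivL : W21 →L[ℂ] L2 := deriv.mkContinuous 1 fun y => by
  rw [one_mul]; exact norm_deriv_le y

def toL2L : W21 →L[ℂ] L2 := toL2.mkContinuous 1 fun y => by
  rw [one_mul]; exact norm_toL2_le y

def toCL : W21 →L[ℂ] C(I, ℂ) := toC.mkContinuous 3 norm_toC_le

theorem isClosed_sobolevGraph : IsClosed (sobolevGraph : Set (C(I, ℂ) × L2)) := by
  have h : (sobolevGraph : Set (C(I, ℂ) × L2)) =
      ⋂ x : I, {w | w.1 x = w.1 0 + inner ℂ (indicatorConstLp 2 measurableSet_Icc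
        (measure_ne_top (volume : Measure I) (Icc 0 x)) (1 : ℂ)) w.2} := by
    ext w
    simp only [L2.inner_indicatorConstLp_one, mem_iInter]
    rfl
  rw [h]
  refine isClosed_iInter fun x => isClosed_eq ?_ ?_
  · exact (continuous_eval_const x).comp continuous_fst
  · exact ((continuous_eval_const 0).comp continuous_fst).add
      (continuous_const.inner continuous_snd)

instance : CompleteSpace W21 := by
  let e : W21 →L[ℂ] C(I, ℂ) × L2 := toCL.prod derivL
  have h1 : ∀ y : W21, ‖y‖ ≤ (2 : NNReal) * ‖e y‖ := by
    intro y
    have h2 : ‖deriv y‖ ≤ ‖e y‖ := norm_snd_le (e y)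
    have h3 : ‖toL2 y‖ ≤ ‖e y‖ := (norm_toLp_le _).trans (norm_fst_le (e y))
    refine le_of_sq_le_sq ?_ (by positivity)
    rw [norm_sq, NNReal.coe_ofNat]
    nlinarith [norm_nonneg (deriv y), norm_nonneg (toL2 y)]
  have h2 : range e = sobolevGraph := Subtype.range_coe
  rw [completeSpace_iff_isComplete_range
    ((e.antilipschitz_of_bound h1).isUniformInducing e.uniformContinuous), h2]
  exact isClosed_sobolevGraph.isComplete

theorem integral_mul_integral {f g : I → ℂ} {x : I} (hf : Integrable f volume)
    (hg : Integrable g volume) {F G : I → ℂ} (hF : Continuous F) (hG : Continuous G)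
    (hFf : ∀ t, F t = ∫ s in Icc 0 t, f s) (hGg : ∀ t, G t = ∫ s in Icc 0 t, g s) :
    F x * G x = ∫ t in Icc 0 x, (f t * G t + F t * g t) := by
  set ν : Measure I := volume.restrict (Icc 0 x) with hν
  have hf' : Integrable f ν := hf.restrict
  have hg' : Integrable g ν := hg.restrict
  have hfg : Integrable (fun z : I × I => f z.1 * g z.2) (ν.prod ν) := hf'.mul_prod hg'
  have hS : MeasurableSet {z : I × I | z.2 ≤ z.1} :=
    (isClosed_le continuous_snd continuous_fst).measurableSet
  have hin : ∀ {h : I → ℂ} {t : I}, t ∈ Icc 0 x → ∫ s in Iic t, h s ∂ν = ∫ s in Icc 0 t, h s := by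
    intro h t ht
    rw [hν, Measure.restrict_restrict measurableSet_Iic]
    congr 2
    ext s
    simp only [mem_inter_iff, mem_Iic, mem_Icc]
    exact ⟨fun h => ⟨h.2.1, h.1⟩, fun h => ⟨h.2, h.1, h.2.trans ht.2⟩⟩
  have hFi : Integrable (fun t => F t * g t) ν := by
    obtain ⟨C, hC⟩ := isCompact_univ.exists_bound_of_continuousOn hF.continuousOn
    exact hg'.bdd_mul hF.aestronglyMeasurable (Filter.Eventually.of_forall fun t => hC t (mem_univ t))
  have hGi : Integrable (fun t => f t * G t) ν := by
    obtain ⟨C, hC⟩ := isCompact_univ.exists_bound_of_continuousOn hG.continuousOn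
    exact hf'.mul_bdd hG.aestronglyMeasurable (Filter.Eventually.of_forall fun t => hC t (mem_univ t))
  rw [integral_add hGi hFi, hFf x, hGg x, ← integral_prod_mul, ← integral_add_compl hS hfg]
  congr 1
  · rw [← integral_indicator hS, integral_prod _ (hfg.indicator hS)]
    refine setIntegral_congr_fun measurableSet_Icc fun s hs => ?_
    have h : ∀ t, {z : I × I | z.2 ≤ z.1}.indicator (fun z : I × I => f z.1 * g z.2) (s, t) =
        f s * (Iic s).indicator g t := by
      intro t
      by_cases hts : t ≤ s <;> simp [indicator, hts]
    simp only [h]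
    rw [integral_const_mul, integral_indicator measurableSet_Iic, hin hs, ← hGg]
  · rw [← integral_indicator hS.compl, integral_prod_symm _ (hfg.indicator hS.compl)]
    refine setIntegral_congr_fun measurableSet_Icc fun t ht => ?_
    have h : ∀ s, {z : I × I | z.2 ≤ z.1}ᶜ.indicator (fun z : I × I => f z.1 * g z.2) (s, t) =
        (Iio t).indicator f s * g t := by
      intro s
      by_cases hts : s < t <;> simp [indicator, hts]
    simp only [h]
    rw [integral_mul_const, integral_indicator measurableSet_Iio, ← integral_Iic_eq_integral_Iio,
      hin ht, ← hFf]

theorem integrable_L2 (g : L2) : Integrable g volume := (Lp.memLp g).integrable (by norm_num)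

/-- The product `f g` of a continuous function and an element of `L_2[0,1]`. -/
def mulL2 (f : C(I, ℂ)) (g : L2) : L2 := (ContinuousMap.toLp ⊤ volume ℂ f : Lp ℂ ⊤ volume) • g

theorem coeFn_mulL2 (f : C(I, ℂ)) (g : L2) : ∀ᵐ t, mulL2 f g t = f t * g t := by
  filter_upwards [Lp.coeFn_lpSMul (r := 2) (ContinuousMap.toLp ⊤ volume ℂ f : Lp ℂ ⊤ volume) g,
    ContinuousMap.coeFn_toLp (p := ⊤) (𝕜 := ℂ) (volume : Measure I) f] with t h h'
  rw [mulL2, h, Pi.smul_apply', h', smul_eq_mul]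

theorem norm_mulL2_le (f : C(I, ℂ)) (g : L2) : ‖mulL2 f g‖ ≤ ‖f‖ * ‖g‖ := by
  refine (Lp.norm_smul_le _ _).trans (mul_le_mul_of_nonneg_right ?_ (norm_nonneg _))
  have h := (ContinuousMap.toLp (E := ℂ) ⊤ (volume : Measure I) ℂ).le_of_opNorm_le
    (ContinuousMap.toLp_norm_le (p := ⊤) (E := ℂ) (𝕜 := ℂ) (volume : Measure I)) f
  simpa using h

/-- The Sobolev function `ȳ z`, with derivative `ȳ z' + z (y')‾`. -/
def conjMul (y z : W21) : W21 :=
  ⟨(star (toC y) * toC z, mulL2 (star (toC y)) (deriv z) + mulL2 (toC z) (star (deriv y))), by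
    intro x
    have hstar : ∀ᵐ t, (star (deriv y) : L2) t = conj (deriv y t) := Lp.coeFn_star _
    have hsum : ∀ᵐ t ∂(volume.restrict (Icc 0 x)),
        (mulL2 (star (toC y)) (deriv z) + mulL2 (toC z) (star (deriv y)) : L2) t =
        (conj (y 0) * deriv z t + conj (deriv y t) * z 0) +
        (conj (deriv y t) * (z t - z 0) + conj (y t - y 0) * deriv z t) := by
      refine ae_restrict_of_ae ?_
      filter_upwards [hstar, Lp.coeFn_add (mulL2 (star (toC y)) (deriv z))
        (mulL2 (toC z) (star (deriv y))), coeFn_mulL2 (star (toC y)) (deriv z),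
        coeFn_mulL2 (toC z) (star (deriv y))] with t h1 h2 h3 h4
      rw [h2, Pi.add_apply, h3, h4, h1, map_sub]
      simp only [ContinuousMap.star_apply, RCLike.star_def]
      ring
    have hz := integrable_L2 (deriv z)
    have hy : Integrable (fun t => conj (deriv y t)) volume :=
      (integrable_L2 (star (deriv y))).congr hstar
    have hF : Continuous fun t => conj (y t - y 0) :=
      Complex.continuous_conj.comp ((toC y).continuous.sub continuous_const)
    have hG : Continuous fun t => z t - z 0 := (toC z).continuous.sub continuous_const
    have key := integral_mul_integral (x := x) hy hz hF hG
      (fun t => by rw [integral_conj, y.eq_add_integral t]; simp)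
      (fun t => by rw [z.eq_add_integral t]; simp)
    have hFi : Integrable (fun t => conj (y t - y 0) * deriv z t) (volume.restrict (Icc 0 x)) := by
      obtain ⟨C, hC⟩ := isCompact_univ.exists_bound_of_continuousOn hF.continuousOn
      exact hz.restrict.bdd_mul hF.aestronglyMeasurable
        (Filter.Eventually.of_forall fun t => hC t (mem_univ t))
    have hGi : Integrable (fun t => conj (deriv y t) * (z t - z 0))
        (volume.restrict (Icc 0 x)) := by
      obtain ⟨C, hC⟩ := isCompact_univ.exists_bound_of_continuousOn hG.continuousOn
      exact hy.restrict.mul_bdd hG.aestronglyMeasurable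
        (Filter.Eventually.of_forall fun t => hC t (mem_univ t))
    simp only [integral_congr_ae hsum]
    have hP : Integrable (fun t => conj (y 0) * deriv z t + conj (deriv y t) * z 0)
        (volume.restrict (Icc 0 x)) := (hz.restrict.const_mul _).add (hy.restrict.mul_const _)
    have hQ : Integrable (fun t => conj (deriv y t) * (z t - z 0) +
        conj (y t - y 0) * deriv z t) (volume.restrict (Icc 0 x)) := hGi.add hFi
    rw [integral_add hP hQ,
      integral_add (hz.restrict.const_mul _) (hy.restrict.mul_const _), ← key,
      integral_const_mul, integral_mul_const, integral_conj]
    have ey := y.eq_add_integral x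
    have ez := z.eq_add_integral x
    have ey' : ∫ t in Icc 0 x, deriv y t = y x - y 0 := by rw [ey]; ring
    have ez' : ∫ t in Icc 0 x, deriv z t = z x - z 0 := by rw [ez]; ring
    rw [ey', ez']
    simp only [ContinuousMap.mul_apply, ContinuousMap.star_apply, RCLike.star_def, map_sub]
    ring⟩

theorem conjMul_apply (y z : W21) (x : I) : conjMul y z x = conj (y x) * z x := rfl

end W21

namespace W21

theorem eq_zero_of_integral {g : L2} (h : ∀ x : I, ∫ t in Icc 0 x, g t = 0) : g = 0 := by
  have hg := integrable_L2 g
  have huniv : ∫ t, g t = 0 := by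
    rw [← setIntegral_univ, ← h 1]
    congr 2
    ext t
    simp [unitInterval.le_one']
  have key : ∀ s : Set I, MeasurableSet s → ∫ t in s, g t = 0 := by
    intro s hs
    induction s, hs using MeasurableSpace.induction_on_inter (borel_eq_generateFrom_Iic I ▸
      (BorelSpace.measurable_eq (α := I))) isPiSystem_Iic with
    | empty => simp
    | basic s hs =>
      obtain ⟨x, rfl⟩ := hs
      rw [← h x]
      congr 2
      ext t
      simp
    | compl s hs ih => rw [setIntegral_compl hs hg, huniv, ih, sub_zero]
    | iUnion f hd hf ih =>
      rw [integral_iUnion hf hd hg.integrableOn]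
      simp [ih]
  have h1 : (g : I → ℂ) =ᵐ[volume] 0 :=
    hg.ae_eq_zero_of_forall_setIntegral_eq_zero fun s hs _ => key s hs
  exact (Lp.eq_zero_iff_ae_eq_zero).2 h1

theorem eq_zero_of_toL2 {y : W21} (h : toL2 y = 0) : y = 0 := by
  have : (volume : Measure I).IsOpenPosMeasure := ⟨fun O hO hne => by
    obtain ⟨a, b, hab, hs⟩ := hO.exists_Ioo_subset hne
    refine (lt_of_lt_of_le ?_ (measure_mono hs)).ne'
    rw [unitInterval.volume_Ioo]
    simpa using hab⟩
  have h0 : toC y = 0 := ContinuousMap.toLp_injective (p := 2) (𝕜 := ℂ) (volume : Measure I)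
    (h.trans (map_zero _).symm)
  refine ext (h0.trans (map_zero _).symm) ?_
  rw [map_zero]
  refine eq_zero_of_integral fun x => ?_
  have hx := y.eq_add_integral x
  simpa [h0] using hx.symm

/-- A Sobolev function is determined by its values. -/
theorem ext_fun {y z : W21} (h : ∀ x : I, y x = z x) : y = z := by
  rw [← sub_eq_zero]
  refine eq_zero_of_toL2 ?_
  have h0 : toC (y - z) = 0 := by
    ext x
    simp [map_sub, h x]
  change ContinuousMap.toLp 2 volume ℂ (toC (y - z)) = 0
  rw [h0, map_zero]

theorem conjMul_add_left (y₁ y₂ z : W21) :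
    conjMul (y₁ + y₂) z = conjMul y₁ z + conjMul y₂ z := by
  refine ext_fun fun x => ?_
  simp only [conjMul_apply, map_add, ContinuousMap.add_apply, add_mul]

theorem conjMul_add_right (y z₁ z₂ : W21) :
    conjMul y (z₁ + z₂) = conjMul y z₁ + conjMul y z₂ := by
  refine ext_fun fun x => ?_
  simp only [conjMul_apply, map_add, ContinuousMap.add_apply, mul_add]

theorem conjMul_smul_left (c : ℂ) (y z : W21) : conjMul (c • y) z = conj c • conjMul y z := by
  refine ext_fun fun x => ?_
  simp only [conjMul_apply, map_smul, ContinuousMap.smul_apply, smul_eq_mul, map_mul, mul_assoc]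

theorem conjMul_smul_right (c : ℂ) (y z : W21) : conjMul y (c • z) = c • conjMul y z := by
  refine ext_fun fun x => ?_
  simp only [conjMul_apply, map_smul, ContinuousMap.smul_apply, smul_eq_mul]
  ring

theorem norm_star_toC (y : W21) : ‖star (toC y)‖ = ‖toC y‖ := by
  simp only [ContinuousMap.norm_eq_iSup_norm, ContinuousMap.star_apply, norm_star]

theorem norm_star_L2 (g : L2) : ‖star g‖ = ‖g‖ := by
  refine le_antisymm ?_ ?_ <;> refine Lp.norm_le_norm_of_ae_le ?_ <;>
    filter_upwards [Lp.coeFn_star g] with x hx <;> simp [hx]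

theorem norm_conjMul_le (y z : W21) : ‖conjMul y z‖ ≤ 11 * ‖y‖ * ‖z‖ := by
  have hy := norm_toC_le y
  have hz := norm_toC_le z
  have hy' := norm_deriv_le y
  have hz' := norm_deriv_le z
  have h0 := norm_nonneg y
  have h0' := norm_nonneg z
  have hd : ‖deriv (conjMul y z)‖ ≤ 6 * ‖y‖ * ‖z‖ := by
    refine (norm_add_le _ _).trans ?_
    have h1 := norm_mulL2_le (star (toC y)) (deriv z)
    have h2 := norm_mulL2_le (toC z) (star (deriv y))
    rw [norm_star_toC] at h1
    rw [norm_star_L2] at h2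
    have h3 : ‖toC y‖ * ‖deriv z‖ ≤ 3 * ‖y‖ * ‖z‖ :=
      mul_le_mul hy hz' (norm_nonneg _) (by positivity)
    have h4 : ‖toC z‖ * ‖deriv y‖ ≤ 3 * ‖z‖ * ‖y‖ :=
      mul_le_mul hz hy' (norm_nonneg _) (by positivity)
    linarith
  have hl : ‖toL2 (conjMul y z)‖ ≤ 9 * ‖y‖ * ‖z‖ := by
    refine (norm_toLp_le _).trans ((norm_mul_le (star (toC y)) (toC z)).trans ?_)
    rw [norm_star_toC]
    have h3 : ‖toC y‖ * ‖toC z‖ ≤ 3 * ‖y‖ * (3 * ‖z‖) :=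
      mul_le_mul hy hz (norm_nonneg _) (by positivity)
    linarith
  refine le_of_sq_le_sq ?_ (by positivity)
  rw [norm_sq]
  have h5 := pow_le_pow_left₀ (norm_nonneg _) hd 2
  have h6 := pow_le_pow_left₀ (norm_nonneg _) hl 2
  have h7 : 0 ≤ (‖y‖ * ‖z‖) ^ 2 := sq_nonneg _
  nlinarith

end W21

/-! ### The spaces `W_2^{-1}[0,1]`, `𝔥_U` and `𝔥_U'` -/

/-- The space `W_2^{-1}[0,1]`: the dual of `W_2^1[0,1]`. The value `q f` stands for
`∫ q f dx` (without conjugation). -/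
abbrev Wm1 : Type := W21 →L[ℂ] ℂ

/-- The vector `y^∧ = (y(0), y(1))`. -/
def bdry : W21 →L[ℂ] (Fin 2 → ℂ) :=
  ContinuousLinearMap.pi
    ![(ContinuousMap.evalCLM ℂ (0 : I)).comp W21.toCL, (ContinuousMap.evalCLM ℂ (1 : I)).comp W21.toCL]

theorem bdry_apply (y : W21) : bdry y = ![y 0, y 1] := by
  ext k
  fin_cases k <;> rfl

/-- The space `𝔥_U = {y ∈ W_2^1[0,1] : y^∧ ∈ im (U - 1)}`, as a Hilbert subspace of
`W_2^1[0,1]`. -/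
def HU (U : Matrix (Fin 2) (Fin 2) ℂ) : Submodule ℂ W21 :=
  (LinearMap.range (U - 1).mulVecLin).comap bdry.toLinearMap

theorem isClosed_HU (U : Matrix (Fin 2) (Fin 2) ℂ) : IsClosed (HU U : Set W21) :=
  (Submodule.closed_of_finiteDimensional (LinearMap.range (U - 1).mulVecLin)).preimage
    bdry.continuous

instance (U : Matrix (Fin 2) (Fin 2) ℂ) : CompleteSpace (HU U) :=
  (isClosed_HU U).completeSpace_coe

/-- The embedding `I : 𝔥_U → L_2[0,1]`. -/
def embL2 (U : Matrix (Fin 2) (Fin 2) ℂ) : HU U →L[ℂ] L2 := W21.toL2L.comp (HU U).subtypeL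

/-- The space `L_2[0,1]` with the norm `‖I^* y‖`. -/
def PreDual (_U : Matrix (Fin 2) (Fin 2) ℂ) : Type := L2

namespace PreDual

variable (U : Matrix (Fin 2) (Fin 2) ℂ)

instance : AddCommGroup (PreDual U) := inferInstanceAs (AddCommGroup L2)

instance : Module ℂ (PreDual U) := inferInstanceAs (Module ℂ L2)

/-- The adjoint `I^*` of the embedding `I : 𝔥_U → L_2[0,1]`. -/
def adj : PreDual U →ₗ[ℂ] HU U := (ContinuousLinearMap.adjoint (embL2 U)).toLinearMap

instance : SeminormedAddCommGroup (PreDual U) := SeminormedAddCommGroup.induced _ _ (adj U)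

instance : NormedSpace ℂ (PreDual U) := NormedSpace.induced ℂ (PreDual U) (HU U) (adj U)

theorem norm_def (f : PreDual U) : ‖f‖ = ‖adj U f‖ := rfl

def adjL : PreDual U →L[ℂ] HU U := (adj U).mkContinuous 1 fun f => by rw [one_mul, norm_def]

end PreDual

/-- The space `𝔥_U'`: the completion of `L_2[0,1]` in the norm `‖I^* y‖`. -/
abbrev HU' (U : Matrix (Fin 2) (Fin 2) ℂ) : Type := UniformSpace.Completion (PreDual U)

/-- The continuous extension `I^+ : 𝔥_U' → 𝔥_U` of `I^*`. -/
def Iplus (U : Matrix (Fin 2) (Fin 2) ℂ) : HU' U →L[ℂ] HU U :=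
  (PreDual.adjL U).extend (UniformSpace.Completion.toComplL : PreDual U →L[ℂ] HU' U)

theorem Iplus_coe (U : Matrix (Fin 2) (Fin 2) ℂ) (f : PreDual U) :
    Iplus U (f : HU' U) = PreDual.adj U f :=
  ContinuousLinearMap.extend_eq _ UniformSpace.Completion.denseRange_coe
    (UniformSpace.Completion.isUniformInducing_coe _) f

theorem norm_Iplus (U : Matrix (Fin 2) (Fin 2) ℂ) (f : HU' U) : ‖Iplus U f‖ = ‖f‖ := by
  induction f using UniformSpace.Completion.induction_on with
  | hp => exact isClosed_eq (Iplus U).continuous.norm continuous_norm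
  | ih f => rw [Iplus_coe, UniformSpace.Completion.norm_coe, PreDual.norm_def]

theorem Iplus_surjective (U : Matrix (Fin 2) (Fin 2) ℂ) : Function.Surjective (Iplus U) := by
  let J : HU' U →ₗᵢ[ℂ] HU U := ⟨(Iplus U).toLinearMap, norm_Iplus U⟩
  have hcl : IsClosed (range (Iplus U)) := J.isometry.isClosedEmbedding.isClosed_range
  have hker : (embL2 U).ker = ⊥ := by
    rw [LinearMap.ker_eq_bot']
    intro y hy
    exact Subtype.ext (W21.eq_zero_of_toL2 hy)
  have hd : Dense (range (PreDual.adj U)) := by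
    have h1 := ContinuousLinearMap.orthogonal_range (ContinuousLinearMap.adjoint (embL2 U))
    rw [ContinuousLinearMap.adjoint_adjoint, hker] at h1
    have h2 := (Submodule.topologicalClosure_eq_top_iff (K := _)).2 h1
    rw [← Submodule.dense_iff_topologicalClosure_eq_top] at h2
    exact h2
  have h : range (PreDual.adj U) ⊆ range (Iplus U) := by
    rintro _ ⟨f, rfl⟩
    exact ⟨f, Iplus_coe U f⟩
  exact fun y => hcl.closure_subset_iff.2 h (hd y)

/-! ### The operator pencil -/

/-- The diagonal Hermitian matrix `V`. -/
def matV (U : Matrix (Fin 2) (Fin 2) ℂ) : Matrix (Fin 2) (Fin 2) ℂ :=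
  Matrix.diagonal fun k => if U k k = 1 then 0 else ((-Real.cot ((U k k).arg / 2) : ℝ) : ℂ)

open Matrix in
/-- The form `∫ p |y'|² dx + ∫ (q - λ r) |y|² dx + ⟨V y^∧, y^∧⟩`. -/
def form (U : Matrix (Fin 2) (Fin 2) ℂ) (p : LInf) (q r : Wm1) (μ : ℂ) (y : W21) : ℂ :=
  ((∫ x, p x * ‖W21.deriv y x‖ ^ 2 : ℝ) : ℂ) + (q - μ • r) (W21.conjMul y y) +
    star (bdry y) ⬝ᵥ (matV U *ᵥ bdry y)

/-- `T` is the operator pencil given by the identity `⟨I^+ T(λ) y, y⟩ = form(λ, y)` in `𝔥_U`;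
Mathlib's `inner ℂ y z` is linear in `z`. -/
def IsPencil (U : Matrix (Fin 2) (Fin 2) ℂ) (p : LInf) (q r : Wm1)
    (T : ℂ → HU U →L[ℂ] HU' U) : Prop :=
  ∀ (μ : ℂ) (y : HU U), inner ℂ y (Iplus U (T μ y)) = form U p q r μ y

open Matrix in
theorem existsUnique_pencil (U : Matrix (Fin 2) (Fin 2) ℂ) (p : LInf) (q r : Wm1) :
    ∃! T : ℂ → HU U →L[ℂ] HU' U, IsPencil U p q r T := by
  -- bounded operators with the quadratic form of a functional
  have hB : ∀ f : Wm1, ∃ A : HU U →L[ℂ] HU U, ∀ y : HU U,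
      inner ℂ y (A y) = f (W21.conjMul y y) := by
    intro f
    let B : HU U →ₗ⋆[ℂ] HU U →ₗ[ℂ] ℂ := LinearMap.mk₂'ₛₗ (starRingEnd ℂ) (RingHom.id ℂ)
      (fun y z => f (W21.conjMul y z))
      (fun y₁ y₂ z => by rw [Submodule.coe_add, W21.conjMul_add_left, map_add])
      (fun c y z => by rw [Submodule.coe_smul, W21.conjMul_smul_left, map_smul])
      (fun y z₁ z₂ => by rw [Submodule.coe_add, W21.conjMul_add_right, map_add])
      (fun c y z => by rw [Submodule.coe_smul, W21.conjMul_smul_right, map_smul]; rfl)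
    let B' : HU U →L⋆[ℂ] HU U →L[ℂ] ℂ := B.mkContinuous₂ (11 * ‖f‖) fun y z => by
      refine (f.le_opNorm _).trans ?_
      have h := mul_le_mul_of_nonneg_left (W21.norm_conjMul_le y z) (norm_nonneg f)
      simp only [Submodule.coe_norm] at h ⊢
      linarith
    refine ⟨ContinuousLinearMap.adjoint (InnerProductSpace.continuousLinearMapOfBilin B'),
      fun y => ?_⟩
    rw [ContinuousLinearMap.adjoint_inner_right,
      InnerProductSpace.continuousLinearMapOfBilin_apply]
    rfl
  -- the leading term
  have hP : ∃ A : HU U →L[ℂ] HU U, ∀ y : HU U,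
      inner ℂ y (A y) = ((∫ x, p x * ‖W21.deriv y x‖ ^ 2 : ℝ) : ℂ) := by
    let M : L2 →ₗ[ℂ] L2 := ⟨⟨fun g => p • g, fun g h => Lp.add_smul _ _ _⟩,
      fun c g => by
        refine Lp.ext ?_
        filter_upwards [Lp.coeFn_lpSMul (r := 2) p (c • g), Lp.coeFn_lpSMul (r := 2) p g,
          Lp.coeFn_smul c g, Lp.coeFn_smul c (HSMul.hSMul p g : L2)] with x h1 h2 h3 h4
        rw [RingHom.id_apply, h4, h1, Pi.smul_apply', h3, Pi.smul_apply, Pi.smul_apply, h2,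
          Pi.smul_apply', smul_comm]⟩
    let M' : L2 →L[ℂ] L2 := M.mkContinuous ‖p‖ fun g => Lp.norm_smul_le p g
    let D : HU U →L[ℂ] L2 := W21.derivL.comp (HU U).subtypeL
    refine ⟨(ContinuousLinearMap.adjoint D).comp (M'.comp D), fun y => ?_⟩
    rw [ContinuousLinearMap.comp_apply, ContinuousLinearMap.adjoint_inner_right, MeasureTheory.L2.inner_def]
    refine Eq.trans ?_ (integral_ofReal (𝕜 := ℂ))
    refine integral_congr_ae ?_
    filter_upwards [Lp.coeFn_lpSMul (r := 2) p (D y)] with x hx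
    change inner ℂ (D y x) ((HSMul.hSMul p (D y) : L2) x) = _
    rw [hx, Pi.smul_apply', inner_smul_right_eq_smul, inner_self_eq_norm_sq_to_K]
    change p x • ((‖D y x‖ : ℂ) ^ 2) = _
    rw [Complex.real_smul]
    push_cast
    rfl
  -- the boundary term
  have hV : ∃ A : HU U →L[ℂ] HU U, ∀ y : HU U,
      inner ℂ y (A y) = star (bdry y) ⬝ᵥ (matV U *ᵥ bdry y) := by
    let e : Fin 2 → HU U →L[ℂ] ℂ := fun k =>
      (ContinuousLinearMap.proj k).comp (bdry.comp (HU U).subtypeL)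
    let v : Fin 2 → ℂ := fun k => matV U k k
    refine ⟨∑ k, v k • (ContinuousLinearMap.adjoint (e k)).comp (e k), fun y => ?_⟩
    simp only [_root_.sum_apply, inner_sum, _root_.smul_apply,
      inner_smul_right, ContinuousLinearMap.comp_apply, ContinuousLinearMap.adjoint_inner_right]
    have h : ∀ k, e k y = bdry y k := fun k => rfl
    simp only [h, RCLike.inner_apply, dotProduct, matV, Matrix.mulVec_diagonal, v,
      Matrix.diagonal_apply_eq, Pi.star_apply, RCLike.star_def]
    exact Finset.sum_congr rfl fun k _ => by ring
  obtain ⟨P, hP⟩ := hP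
  obtain ⟨V, hV⟩ := hV
  obtain ⟨Q, hQ⟩ := hB q
  obtain ⟨R, hR⟩ := hB r
  let J : HU' U →ₗᵢ[ℂ] HU U := ⟨(Iplus U).toLinearMap, norm_Iplus U⟩
  let E : HU' U ≃ₗᵢ[ℂ] HU U := LinearIsometryEquiv.ofSurjective J (Iplus_surjective U)
  have hE : ∀ y : HU U, Iplus U (E.symm y) = y := E.apply_symm_apply
  refine ⟨fun μ => (E.symm : HU U →L[ℂ] HU' U).comp (P + (Q - μ • R) + V), ?_, ?_⟩
  · intro μ y
    change inner ℂ y (Iplus U (E.symm ((P + (Q - μ • R) + V) y))) = _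
    rw [hE]
    simp only [_root_.add_apply, _root_.sub_apply,
      _root_.smul_apply, inner_add_right, inner_sub_right, inner_smul_right, hP, hQ,
      hR, hV, form, smul_eq_mul]
  · intro T hT
    funext μ
    have h : ((Iplus U).comp (T μ)).toLinearMap = (P + (Q - μ • R) + V).toLinearMap := by
      rw [← ext_inner_map]
      intro y
      rw [← inner_conj_symm, ← inner_conj_symm (((P + (Q - μ • R) + V).toLinearMap) y) y]
      refine congrArg _ ((hT μ y).trans ?_)
      simp only [ContinuousLinearMap.coe_coe, _root_.add_apply,
        _root_.sub_apply, _root_.smul_apply, inner_add_right,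
        inner_sub_right, inner_smul_right, hP, hQ, hR, hV, form, smul_eq_mul]
    ext1 y
    refine E.injective ?_
    exact (LinearMap.congr_fun h y).trans (E.apply_symm_apply _).symm

/-- The operator pencil `T : ℂ → L(𝔥_U, 𝔥_U')`. -/
def pencil (U : Matrix (Fin 2) (Fin 2) ℂ) (p : LInf) (q r : Wm1) : ℂ → HU U →L[ℂ] HU' U :=
  (existsUnique_pencil U p q r).choose

theorem isPencil_pencil (U : Matrix (Fin 2) (Fin 2) ℂ) (p : LInf) (q r : Wm1) :
    IsPencil U p q r (pencil U p q r) :=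
  (existsUnique_pencil U p q r).choose_spec.1

/-! ### Coefficients and boundary conditions -/

/-- `p` is uniformly positive. -/
def UniformlyPositive (p : LInf) : Prop := ∃ m : ℝ, 0 < m ∧ ∀ᵐ x, m ≤ p x

/-- A functional of class `W_2^{-1}[0,1]` is nonnegative: its values at nonnegative functions are
nonnegative reals. -/
def Nonneg (r : Wm1) : Prop :=
  ∀ f : W21, (∀ x : I, (f x).im = 0 ∧ 0 ≤ (f x).re) → (r f).im = 0 ∧ 0 ≤ (r f).re

/-- The support of `r` is the whole of `[0,1]`: `r` does not vanish on any open subinterval. -/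
def FullSupport (r : Wm1) : Prop :=
  ∀ a b : I, a < b → ∃ f : W21, (∀ x ∉ Ioo a b, f x = 0) ∧ r f ≠ 0

open Matrix in
/-- The boundary condition `(U - 1) y^∨ + i (U + 1) y^∧ = 0` for the boundary data
`y0 = y(0)`, `y1 = y(1)`, `d0 = y^{[1]}(0)`, `d1 = y^{[1]}(1)`, where `y^∧ = (y0, y1)` and
`y^∨ = (d0, -d1)`. -/
def BoundaryCondition (U : Matrix (Fin 2) (Fin 2) ℂ) (y0 y1 d0 d1 : ℂ) : Prop :=
  (U - 1) *ᵥ ![d0, -d1] + Complex.I • ((U + 1) *ᵥ ![y0, y1]) = 0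

/-! ### Strong sign-regularity -/

/-- `f` has at least `n` sign changes on `(0,1)`. -/
def HasSignChanges (f : I → ℝ) (n : ℕ) : Prop :=
  ∃ x : Fin (n + 1) → I, StrictMono x ∧ (∀ k, 0 < x k ∧ x k < 1) ∧
    ∀ k : Fin n, f (x k.castSucc) * f (x k.succ) < 0

/-- `f` has at least `n` pseudo-zeros on `(0,1)`. -/
def HasPseudoZeros (f : I → ℝ) (n : ℕ) : Prop :=
  ∃ ε : ℝ, 0 < ε ∧ ∃ x : Fin (n + 1) → I, StrictMono x ∧ (∀ k, 0 < x k ∧ x k < 1) ∧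
    (∀ k, ε < |f (x k)|) ∧
    ∀ k : Fin n, ∃ t ∈ Ioo (x k.castSucc) (x k.succ), |f t| < ε

/-- `y` is a real function. -/
def W21.IsReal (y : W21) : Prop := ∀ x : I, (y x).im = 0

/-- A strongly sign-regular operator in `𝔥_U`. -/
structure StronglySignRegular {U : Matrix (Fin 2) (Fin 2) ℂ} (K : HU U →L[ℂ] HU U) : Prop where
  isReal : ∀ y : HU U, W21.IsReal y → W21.IsReal (K y)
  signChanges : ∀ (n : ℕ) (y : HU U), W21.IsReal y →
    HasPseudoZeros (fun x => ((K y : W21) x).re) n → HasSignChanges (fun x => ((y : W21) x).re) n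

end SturmLiouville

end

open SturmLiouville

namespace SturmLiouville

/-! ### Primitives, constants and real parts of Sobolev functions -/

namespace W21

/-! The pencil is affine in `λ` with derivative `-r`, so `w = R y` is the weak solution of `(p w')'
= r y` under the given boundary conditions. Each admissible boundary condition makes the form at `λ
= 0` coercive on `HU U` (`AdmissibleDomain.coercive`), which gives the bounded inverse of `T(0)`.

A nonnegative `r` is a finite measure `ρ` (`Nonneg.exists_measure`). Integrating the weak equation
by parts yields the quasi-derivative explicitly: `p w' = v` almost everywhere, with `v(t) = c -
∫_{[t,1]} y dρ` (`exists_mulLInf_deriv_eq`, `exists_quasiDeriv`). Since `p > 0` and `ρ ≥ 0`, `w` can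
fall only where `v` is negative somewhere, and `v` can fall only where `y` is negative somewhere;
likewise for rising. These two implications replace two uses of Rolle's theorem and need no
smoothness of `v`, which may jump at atoms of `ρ`.

The count is then combinatorial (`hasSignChanges_of_hasPseudoZeros`). Every pseudo-zero of `w`
forces a change of sign of `v`, and a pseudo-zero between two values of the same sign forces two. At
the left end, `w(0) = 0` or `v(0) = 0` gives a value of `v` that agrees with, or at least does not
oppose, the first sign of `w`. At the right end, `w(1) = 0` or `c = -α w(1)` with `α > 0` gives one
more change. So `n` pseudo-zeros of `w` produce `n + 1` increments of `v` of alternating sign, hence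
`n + 1` alternating values of `y`, that is, `n` sign changes. -/

theorem continuous_setIntegral_Icc (g : L2) : Continuous fun x : I => ∫ t in Icc 0 x, g t := by
  have h : (fun x : I => ∫ t in Icc 0 x, g t) = fun x : I => ∫ t, (Icc 0 x).indicator g t := by
    funext x
    rw [integral_indicator measurableSet_Icc]
  rw [h, continuous_iff_continuousAt]
  intro x₀
  have hg := integrable_L2 g
  refine continuousAt_of_dominated (bound := fun t => ‖g t‖)
    (Filter.Eventually.of_forall fun x => hg.aestronglyMeasurable.indicator measurableSet_Icc)
    (Filter.Eventually.of_forall fun x => Filter.Eventually.of_forall fun t =>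
      norm_indicator_le_norm_self _ _) hg.norm ?_
  -- For `t ≠ x₀` the indicator of `Icc 0 x` at `t` is constant for `x` near `x₀`, and the
  -- exceptional point is null.
  have h0 : ∀ᵐ t : I, t ≠ x₀ := by
    rw [ae_iff]
    simp
  filter_upwards [h0] with t ht
  rcases lt_or_gt_of_ne ht with h1 | h1
  · refine (continuousAt_const (y := g t)).congr ?_
    filter_upwards [lt_mem_nhds h1] with x hx
    rw [indicator_of_mem]
    exact ⟨unitInterval.nonneg', le_of_lt hx⟩
  · refine (continuousAt_const (y := 0)).congr ?_
    filter_upwards [gt_mem_nhds h1] with x hx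
    rw [indicator_of_notMem]
    exact fun h => absurd h.2 (not_le.2 hx)

/-- The Sobolev function with derivative `g` and value `a` at `0`. -/
noncomputable def primitive (a : ℂ) (g : L2) : W21 :=
  ⟨(⟨fun x => a + ∫ t in Icc 0 x, g t, continuous_const.add (continuous_setIntegral_Icc g)⟩, g), by
    intro x
    have h0 : ∫ t in Icc (0 : I) 0, g t = 0 := by
      rw [Icc_self, setIntegral_measure_zero _ (measure_singleton _)]
    change a + ∫ t in Icc 0 x, g t = (a + ∫ t in Icc (0 : I) 0, g t) + _
    rw [h0, add_zero]⟩

theorem primitive_apply (a : ℂ) (g : L2) (x : I) :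
    primitive a g x = a + ∫ t in Icc 0 x, g t := rfl

theorem deriv_primitive (a : ℂ) (g : L2) : deriv (primitive a g) = g := rfl

theorem primitive_apply_zero (a : ℂ) (g : L2) : primitive a g 0 = a := by
  rw [primitive_apply, Icc_self, setIntegral_measure_zero _ (measure_singleton _), add_zero]

theorem primitive_apply_one (a : ℂ) (g : L2) : primitive a g 1 = a + ∫ t, g t := by
  have h : Icc (0 : I) 1 = univ := eq_univ_of_forall fun t => ⟨unitInterval.nonneg', unitInterval.le_one'⟩
  rw [primitive_apply, h, setIntegral_univ]

theorem apply_one (y : W21) : y 1 = y 0 + ∫ t, deriv y t := by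
  have h : Icc (0 : I) 1 = univ := eq_univ_of_forall fun t => ⟨unitInterval.nonneg', unitInterval.le_one'⟩
  rw [eq_add_integral y 1, h, setIntegral_univ]

/-- Constant functions as Sobolev functions. -/
noncomputable def const (a : ℂ) : W21 := primitive a 0

theorem const_apply (a : ℂ) (x : I) : const a x = a := by
  have h : ∀ᵐ t ∂(volume.restrict (Icc 0 x)), ((0 : L2) : I → ℂ) t = 0 :=
    ae_restrict_of_ae (Lp.coeFn_zero ℂ 2 volume)
  rw [const, primitive_apply, integral_congr_ae h]
  simp

theorem add_apply (y z : W21) (x : I) : (y + z) x = y x + z x := by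
  simp [map_add]

theorem smul_apply (c : ℂ) (y : W21) (x : I) : (c • y) x = c * y x := by
  simp [map_smul]

/-- A Sobolev function is a combination of two real ones. -/
theorem exists_real_add_I_smul (f : W21) : ∃ a b : W21, (∀ x, a x = ((f x).re : ℂ)) ∧
    (∀ x, b x = ((f x).im : ℂ)) ∧ f = a + Complex.I • b := by
  have hc : ∀ x, conjMul f (const 1) x = conj (f x) := fun x => by
    rw [conjMul_apply, const_apply, mul_one]
  have ha : ∀ x, ((1 / 2 : ℂ) • (f + conjMul f (const 1))) x = ((f x).re : ℂ) := fun x => by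
    rw [smul_apply, add_apply, hc, Complex.add_conj]
    push_cast; ring
  have hb : ∀ x, ((-Complex.I / 2 : ℂ) • (f + (-1 : ℂ) • conjMul f (const 1))) x =
      ((f x).im : ℂ) := fun x => by
    rw [smul_apply, add_apply, smul_apply, hc, neg_one_mul, ← sub_eq_add_neg, Complex.sub_conj]
    push_cast; linear_combination (-(f x).im : ℂ) * Complex.I_sq
  refine ⟨_, _, ha, hb, ext_fun fun x => ?_⟩
  rw [add_apply, smul_apply Complex.I, ha, hb, mul_comm, Complex.re_add_im]

end W21

/-! ### Nonnegative functionals as measures -/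

/-- A positive linear functional on the continuous functions on `[0,1]` is an integral. -/
theorem exists_measure_of_positive (g : C(I, ℝ) →ₗ[ℝ] ℝ) (hg : ∀ f : C(I, ℝ), 0 ≤ f → 0 ≤ g f) :
    ∃ ρ : Measure I, IsFiniteMeasure ρ ∧ ∀ f : C(I, ℝ), g f = ∫ x, f x ∂ρ := by
  let L : (CompactlySupportedContinuousMap I ℝ) →ₗ[ℝ] ℝ :=
    { toFun := fun f => g f.toContinuousMap
      map_add' := fun a b => g.map_add a.toContinuousMap b.toContinuousMap
      map_smul' := fun c a => g.map_smul c a.toContinuousMap }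
  let Λ : (CompactlySupportedContinuousMap I ℝ) →ₚ[ℝ] ℝ := PositiveLinearMap.mk₀ L fun f hf => hg f.toContinuousMap hf
  refine ⟨RealRMK.rieszMeasure Λ, ?_, fun f => ?_⟩
  · infer_instance
  · exact (RealRMK.integral_rieszMeasure Λ (CompactlySupportedContinuousMap.continuousMapEquiv f)).symm

/-- A nonnegative functional of class `W_2^{-1}[0,1]` is a finite measure. -/
theorem Nonneg.exists_measure {r : Wm1} (hr : Nonneg r) :
    ∃ ρ : Measure I, IsFiniteMeasure ρ ∧ ∀ f : W21, r f = ∫ x, f x ∂ρ := by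
  -- Real Sobolev functions form a subspace of `C(I, ℝ)` on which `r` is a positive real functional.
  -- It is extended to all of `C(I, ℝ)` by M. Riesz's theorem, and positivity of the extension makes
  -- it a measure.
  let D : Submodule ℝ C(I, ℝ) :=
    { carrier := {g | ∃ w : W21, ∀ x, w x = (g x : ℂ)}
      zero_mem' := ⟨0, fun x => by simp⟩
      add_mem' := by
        rintro a b ⟨v, hv⟩ ⟨w, hw⟩
        exact ⟨v + w, fun x => by rw [W21.add_apply, hv, hw]; simp⟩
      smul_mem' := by
        rintro c a ⟨v, hv⟩
        exact ⟨(c : ℂ) • v, fun x => by rw [W21.smul_apply, hv]; simp⟩ }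
  choose ψ hψ using fun g : D => g.2
  let f : C(I, ℝ) →ₗ.[ℝ] ℝ :=
    { domain := D
      toFun :=
        { toFun := fun g => (r (ψ g)).re
          map_add' := fun a b => by
            rw [← Complex.add_re, ← map_add]
            congr 2
            refine W21.ext_fun fun x => ?_
            rw [W21.add_apply, hψ, hψ, hψ]; simp
          map_smul' := fun c a => by
            have : ψ (c • a) = (c : ℂ) • ψ a := by
              refine W21.ext_fun fun x => ?_
              rw [W21.smul_apply, hψ, hψ]; simp
            rw [this, map_smul]; simp } }
  -- A real `w` is a difference of the nonnegative functions `w + ‖w‖` and `‖w‖`, on both of which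
  -- `r` is real.
  have hpos : ∀ w : W21, (∀ x, (w x).im = 0) → (r w).im = 0 := by
    intro w hw
    have h1 := hr (w + W21.const (‖W21.toC w‖ : ℂ)) fun x => by
      rw [W21.add_apply, W21.const_apply]
      have := (W21.toC w).norm_coe_le_norm x
      have h2 := (abs_le.1 ((Complex.abs_re_le_norm (w x)).trans this)).1
      simp only [Complex.add_im, hw x, Complex.ofReal_im, Complex.add_re, Complex.ofReal_re]
      exact ⟨by simp, by linarith⟩
    have h2 := hr (W21.const (‖W21.toC w‖ : ℂ)) fun x => by
      rw [W21.const_apply]; simp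
    rw [map_add, Complex.add_im, h2.1, add_zero] at h1
    exact h1.1
  obtain ⟨g, hgf, hg0⟩ := riesz_extension (PointedCone.positive ℝ C(I, ℝ)) f
    (fun a ha => (hr (ψ a) fun x => by
      rw [hψ]
      exact ⟨Complex.ofReal_im _, by simpa using (ha : (0 : C(I, ℝ)) ≤ a) x⟩).2)
    -- Cofinality for the extension: the constant `‖y‖` belongs to `D` and dominates `-y`.
    (fun y => ⟨⟨ContinuousMap.const I ‖y‖, W21.const (‖y‖ : ℂ), fun x => by
      rw [W21.const_apply]; simp⟩, by
      change (0 : C(I, ℝ)) ≤ _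
      intro x
      have := (abs_le.1 (y.norm_coe_le_norm x)).1
      change 0 ≤ ‖y‖ + y x
      linarith⟩)
  obtain ⟨ρ, hρ, hgρ⟩ := exists_measure_of_positive g fun f hf => hg0 f hf
  have key : ∀ w : W21, ∀ u : I → ℝ, (∀ x, w x = (u x : ℂ)) → r w = ∫ x, w x ∂ρ := by
    intro w u hw
    have hu : Continuous u := by
      have : u = fun x => (w x).re := by funext x; rw [hw]; simp
      rw [this]
      exact Complex.continuous_re.comp (W21.toC w).continuous
    let u' : D := ⟨⟨u, hu⟩, w, hw⟩
    have h1 : ψ u' = w := W21.ext_fun fun x => by rw [hψ, hw]; rfl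
    have h2 : (r w).re = ∫ x, u x ∂ρ := by
      rw [← h1]
      exact (hgf u').symm.trans (hgρ _)
    have h3 : (r w).im = 0 := hpos w fun x => by rw [hw, Complex.ofReal_im]
    rw [← Complex.re_add_im (r w), h2, h3]
    simp only [hw]
    rw [Complex.ofReal_zero, zero_mul, add_zero]
    exact (integral_ofReal (𝕜 := ℂ)).symm
  refine ⟨ρ, hρ, fun w => ?_⟩
  obtain ⟨a, b, ha, hb, hab⟩ := W21.exists_real_add_I_smul w
  have hi : ∀ v : W21, Integrable (fun x => v x) ρ := fun v =>
    (W21.toC v).continuous.integrable_of_hasCompactSupport (HasCompactSupport.of_compactSpace _)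
  rw [hab, map_add, map_smul, key a _ ha, key b _ hb, smul_eq_mul, ← integral_const_mul,
    ← integral_add (hi a) ((hi b).const_mul _)]
  simp only [W21.add_apply, W21.smul_apply]

/-! ### Boundary conditions -/

/-- With `u = exp (2 i θ)` the left side of `h` factors as `exp (i θ) * 2 i (c sin θ + cos θ)`. The
vanishing of the last factor excludes `sin θ = 0`, since sine and cosine have no common zero. -/
theorem neg_cot_half_arg {u : ℂ} (hu : ‖u‖ = 1) {c : ℝ}
    (h : (u - 1) * c + Complex.I * (u + 1) = 0) : -Real.cot (u.arg / 2) = c := by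
  set θ := u.arg / 2 with hθ
  have hu2 : u = (Real.cos θ + Real.sin θ * Complex.I) ^ 2 := by
    conv_lhs => rw [← Complex.norm_mul_exp_arg_mul_I u, hu, Complex.ofReal_one, one_mul]
    rw [Complex.ofReal_cos, Complex.ofReal_sin, ← Complex.exp_mul_I, ← Complex.exp_nat_mul, hθ]
    congr 1
    push_cast; ring
  have hcs : (Real.cos θ : ℂ) ^ 2 + (Real.sin θ : ℂ) ^ 2 = 1 := by
    rw [add_comm]
    exact_mod_cast Real.sin_sq_add_cos_sq θ
  have hne : (Real.cos θ + Real.sin θ * Complex.I : ℂ) ≠ 0 := by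
    intro h0
    rw [h0] at hu2
    rw [hu2] at hu
    norm_num at hu
  have key : (Real.cos θ + Real.sin θ * Complex.I : ℂ) *
      (2 * Complex.I * (Real.sin θ * c + Real.cos θ)) = 0 := by
    rw [← h, hu2]
    linear_combination (Complex.I - c) * hcs +
      ((Real.sin θ : ℂ) ^ 2 * c - (Real.sin θ : ℂ) ^ 2 * Complex.I) * Complex.I_sq
  have h2 : (Real.sin θ * c + Real.cos θ : ℂ) = 0 := by
    rcases mul_eq_zero.1 key with h3 | h3
    · exact absurd h3 hne
    · rcases mul_eq_zero.1 h3 with h4 | h4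
      · simp at h4
      · exact h4
  have h3 : Real.sin θ * c + Real.cos θ = 0 := by exact_mod_cast h2
  have hs : Real.sin θ ≠ 0 := by
    intro h0
    rw [h0, zero_mul, zero_add] at h3
    have := Real.sin_sq_add_cos_sq θ
    rw [h0, h3] at this
    norm_num at this
  rw [Real.cot_eq_cos_div_sin]
  field_simp
  linarith

/-- The matrix `U - 1` is diagonal, so its range constrains exactly the coordinates where its
diagonal entry vanishes: these are the Dirichlet conditions. All other conditions are natural and
enter through `matV`. -/
theorem mem_HU_iff {U : Matrix (Fin 2) (Fin 2) ℂ} (hU : U.IsDiag) (z : W21) :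
    z ∈ HU U ↔ (U 0 0 = 1 → z 0 = 0) ∧ (U 1 1 = 1 → z 1 = 0) := by
  have h01 : U 0 1 = 0 := hU (by decide)
  have h10 : U 1 0 = 0 := hU (by decide)
  change (∃ v, (U - 1).mulVec v = bdry z) ↔ _
  rw [bdry_apply]
  simp only [funext_iff, Fin.forall_fin_two, Matrix.mulVec, dotProduct, Fin.sum_univ_two,
    Matrix.sub_apply, h01, h10, Matrix.one_apply_eq, Matrix.cons_val_zero, Matrix.cons_val_one,
    Matrix.one_apply_ne (show (0 : Fin 2) ≠ 1 by decide),
    Matrix.one_apply_ne (show (1 : Fin 2) ≠ 0 by decide), sub_zero, zero_mul, zero_add, add_zero]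
  constructor
  · rintro ⟨v, h0, h1⟩
    exact ⟨fun h => by rw [← h0, h, sub_self, zero_mul],
      fun h => by rw [← h1, h, sub_self, zero_mul]⟩
  · rintro ⟨h0, h1⟩
    refine ⟨![z 0 / (U 0 0 - 1), z 1 / (U 1 1 - 1)], ?_, ?_⟩
    · by_cases h : U 0 0 = 1
      · simp [h, h0 h]
      · simpa using mul_div_cancel₀ _ (sub_ne_zero.2 h)
    · by_cases h : U 1 1 = 1
      · simp [h, h1 h]
      · simpa using mul_div_cancel₀ _ (sub_ne_zero.2 h)

theorem boundaryCondition_iff {U : Matrix (Fin 2) (Fin 2) ℂ} (hU : U.IsDiag) (y0 y1 d0 d1 : ℂ) :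
    BoundaryCondition U y0 y1 d0 d1 ↔ (U 0 0 - 1) * d0 + Complex.I * ((U 0 0 + 1) * y0) = 0 ∧
      (U 1 1 - 1) * -d1 + Complex.I * ((U 1 1 + 1) * y1) = 0 := by
  have h01 : U 0 1 = 0 := hU (by decide)
  have h10 : U 1 0 = 0 := hU (by decide)
  simp [BoundaryCondition, funext_iff, Fin.forall_fin_two, h01, h10]

theorem norm_apply_self_of_isDiag {U : Matrix (Fin 2) (Fin 2) ℂ}
    (hU : U ∈ Matrix.unitaryGroup (Fin 2) ℂ) (hUd : U.IsDiag) (k : Fin 2) : ‖U k k‖ = 1 := by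
  have h01 : U 0 1 = 0 := hUd (by decide)
  have h10 : U 1 0 = 0 := hUd (by decide)
  have h := congrFun (congrFun (Matrix.mem_unitaryGroup_iff.1 hU) k) k
  have h1 : U k k * conj (U k k) = 1 := by
    fin_cases k <;> simpa [Matrix.mul_apply, Fin.sum_univ_two, h01, h10, Matrix.star_apply] using h
  rw [Complex.mul_conj, Complex.normSq_eq_norm_sq] at h1
  have h2 : ‖U k k‖ ^ 2 = 1 := by exact_mod_cast h1
  exact (pow_eq_one_iff_of_nonneg (norm_nonneg _) two_ne_zero).1 h2

/-- The three kinds of admissible boundary conditions, in terms of the form: `α` is the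
coefficient of `|y(1)|²`. -/
def AdmissibleDomain (H : Submodule ℂ W21) (α : ℝ) : Prop :=
  (α = 0 ∧ ∀ z, z ∈ H ↔ z 0 = 0 ∧ z 1 = 0) ∨ (α = 0 ∧ ∀ z, z ∈ H ↔ z 1 = 0) ∨
    (0 < α ∧ ∀ z, z ∈ H)

/-- Evaluating the equivalence at a single well-chosen boundary datum that satisfies the conditions
already fixes, for each diagonal entry of `U`, whether it is `1` and otherwise the value of its
cotangent term. This translates the conditions into a domain and a coefficient of the form. -/
theorem exists_admissibleDomain {U : Matrix (Fin 2) (Fin 2) ℂ}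
    (hU : U ∈ Matrix.unitaryGroup (Fin 2) ℂ) (hUd : U.IsDiag)
    (hBC :
      (∀ y0 y1 d0 d1 : ℂ, BoundaryCondition U y0 y1 d0 d1 ↔ y0 = 0 ∧ y1 = 0) ∨
      (∀ y0 y1 d0 d1 : ℂ, BoundaryCondition U y0 y1 d0 d1 ↔ d0 = 0 ∧ y1 = 0) ∨
      (∃ C : ℝ, 0 < C ∧ ∀ y0 y1 d0 d1 : ℂ,
        BoundaryCondition U y0 y1 d0 d1 ↔ d0 = 0 ∧ d1 + C * y1 = 0)) :
    ∃ α : ℝ, matV U = Matrix.diagonal ![0, (α : ℂ)] ∧ AdmissibleDomain (HU U) α := by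
  have hI := Complex.I_ne_zero
  have ne_one : ∀ {u : ℂ} {c : ℝ}, (u - 1) * c + Complex.I * (u + 1) = 0 → u ≠ 1 := by
    rintro u c h rfl
    rw [sub_self, zero_mul, zero_add] at h
    rcases mul_eq_zero.1 h with h | h
    · exact hI h
    · norm_num at h
  have hV : ∀ a b : ℂ, (if U 0 0 = 1 then (0 : ℂ) else ((-Real.cot ((U 0 0).arg / 2) : ℝ) : ℂ)) = a →
      (if U 1 1 = 1 then (0 : ℂ) else ((-Real.cot ((U 1 1).arg / 2) : ℝ) : ℂ)) = b →
      matV U = Matrix.diagonal ![a, b] := by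
    intro a b ha hb
    rw [matV]
    congr 1
    funext k
    fin_cases k
    · exact ha
    · exact hb
  simp only [boundaryCondition_iff hUd] at hBC
  rcases hBC with h | h | ⟨C, hC, h⟩
  · have h1 := (h 0 0 1 1).2 ⟨rfl, rfl⟩
    simp only [mul_zero, add_zero, mul_one, mul_neg, neg_eq_zero, sub_eq_zero] at h1
    refine ⟨0, hV _ _ (by rw [if_pos h1.1]) (by rw [if_pos h1.2, Complex.ofReal_zero]),
      Or.inl ⟨rfl, fun z => ?_⟩⟩
    rw [mem_HU_iff hUd]
    simp [h1.1, h1.2]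
  · have h1 := (h 1 0 0 1).2 ⟨rfl, rfl⟩
    have h0 : (U 0 0 - 1) * (0 : ℝ) + Complex.I * (U 0 0 + 1) = 0 := by simpa using h1.1
    have h11 : U 1 1 = 1 := (by simpa [sub_eq_zero] using h1.2 : 1 = U 1 1).symm
    refine ⟨0, hV _ _ ?_ (by rw [if_pos h11, Complex.ofReal_zero]),
      Or.inr (Or.inl ⟨rfl, fun z => ?_⟩)⟩
    · rw [if_neg (ne_one h0), neg_cot_half_arg (norm_apply_self_of_isDiag hU hUd 0) h0,
        Complex.ofReal_zero]
    · rw [mem_HU_iff hUd]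
      simp [ne_one h0, h11]
  · have h1 := (h 1 1 0 (-C)).2 ⟨rfl, by ring⟩
    have h0 : (U 0 0 - 1) * (0 : ℝ) + Complex.I * (U 0 0 + 1) = 0 := by simpa using h1.1
    have h11 : (U 1 1 - 1) * C + Complex.I * (U 1 1 + 1) = 0 := by simpa using h1.2
    refine ⟨C, hV _ _ ?_ ?_, Or.inr (Or.inr ⟨hC, fun z => ?_⟩)⟩
    · rw [if_neg (ne_one h0), neg_cot_half_arg (norm_apply_self_of_isDiag hU hUd 0) h0,
        Complex.ofReal_zero]
    · rw [if_neg (ne_one h11), neg_cot_half_arg (norm_apply_self_of_isDiag hU hUd 1) h11]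
    · rw [mem_HU_iff hUd]
      simp [ne_one h0, ne_one h11]

/-! ### The sesquilinear form of the pencil -/

/-- Two sesquilinear forms with the same diagonal coincide. -/
theorem sesquilin_ext {H : Type*} [AddCommGroup H] [Module ℂ H] {B B' : H →ₗ⋆[ℂ] H →ₗ[ℂ] ℂ}
    (h : ∀ y, B y y = B' y y) : B = B' := by
  refine LinearMap.ext fun z => LinearMap.ext fun y => ?_
  have h1 := h (z + y)
  have h2 := h (z + Complex.I • y)
  have hz := h z
  have hy := h y
  simp only [map_add, LinearMap.add_apply, map_smul, LinearMap.map_smulₛₗ, LinearMap.smul_apply,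
    Complex.conj_I, smul_eq_mul] at h1 h2
  linear_combination (1 / 2) * (h1 - hz - hy) + (-Complex.I / 2) * (h2 - hz) -
    (Complex.I / 2) * (Complex.I ^ 2 * hy) + ((B z y - B' z y) / 2 - (B y z - B' y z) / 2) * Complex.I_sq

/-- Multiplication by an element of `L_∞[0,1]`. -/
noncomputable def mulLInf (p : LInf) : L2 →ₗ[ℂ] L2 where
  toFun g := p • g
  map_add' g h := Lp.add_smul _ _ _
  map_smul' c g := by
    refine Lp.ext ?_
    filter_upwards [Lp.coeFn_lpSMul (r := 2) p (c • g), Lp.coeFn_lpSMul (r := 2) p g,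
      Lp.coeFn_smul c g, Lp.coeFn_smul c (HSMul.hSMul p g : L2)] with x h1 h2 h3 h4
    rw [RingHom.id_apply, h4, h1, Pi.smul_apply', h3, Pi.smul_apply, Pi.smul_apply, h2,
      Pi.smul_apply', smul_comm]

theorem coeFn_mulLInf (p : LInf) (g : L2) : ∀ᵐ x, mulLInf p g x = p x * g x := by
  filter_upwards [Lp.coeFn_lpSMul (r := 2) p g] with x hx
  change (HSMul.hSMul p g : L2) x = _
  rw [hx, Pi.smul_apply', Complex.real_smul]

theorem inner_mulLInf_self (p : LInf) (g : L2) :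
    inner ℂ g (mulLInf p g) = ((∫ x, p x * ‖g x‖ ^ 2 : ℝ) : ℂ) := by
  rw [MeasureTheory.L2.inner_def]
  refine Eq.trans ?_ (integral_ofReal (𝕜 := ℂ))
  refine integral_congr_ae ?_
  filter_upwards [coeFn_mulLInf p g] with x hx
  rw [hx, ← smul_eq_mul, inner_smul_right, inner_self_eq_norm_sq_to_K]
  simp

/-- The pencil is specified only by its quadratic form. Both sides are sesquilinear in `(z, y)`, so
polarization recovers the full form, which is needed for testing against arbitrary `z`. -/
theorem inner_pencil {U : Matrix (Fin 2) (Fin 2) ℂ} {α : ℝ}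
    (hV : matV U = Matrix.diagonal ![0, (α : ℂ)]) (p : LInf) (r : Wm1) (μ : ℂ) (z y : HU U) :
    inner ℂ z (Iplus U (pencil U p 0 r μ y)) =
      inner ℂ (W21.deriv z) (mulLInf p (W21.deriv y)) + α * (conj ((z : W21) 1) * (y : W21) 1) -
        μ * r (W21.conjMul z y) := by
  let B : HU U →ₗ⋆[ℂ] HU U →ₗ[ℂ] ℂ := LinearMap.mk₂'ₛₗ (starRingEnd ℂ) (RingHom.id ℂ)
    (fun z y => inner ℂ (W21.deriv z) (mulLInf p (W21.deriv y)) +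
      α * (conj ((z : W21) 1) * (y : W21) 1) - μ * r (W21.conjMul z y))
    (fun y₁ y₂ z => by
      simp only [Submodule.coe_add, W21.conjMul_add_left, map_add, inner_add_left,
        ContinuousMap.add_apply]
      ring)
    (fun c y z => by
      simp only [Submodule.coe_smul, W21.conjMul_smul_left, map_smul, inner_smul_left,
        ContinuousMap.smul_apply, map_mul, smul_eq_mul]
      ring)
    (fun y z₁ z₂ => by
      simp only [Submodule.coe_add, W21.conjMul_add_right, map_add, inner_add_right,
        ContinuousMap.add_apply]
      ring)
    (fun c y z => by
      simp only [Submodule.coe_smul, W21.conjMul_smul_right, map_smul, inner_smul_right,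
        ContinuousMap.smul_apply, smul_eq_mul, RingHom.id_apply]
      ring)
  let B' : HU U →ₗ⋆[ℂ] HU U →ₗ[ℂ] ℂ := LinearMap.mk₂'ₛₗ (starRingEnd ℂ) (RingHom.id ℂ)
    (fun z y => inner ℂ z (Iplus U (pencil U p 0 r μ y)))
    (fun y₁ y₂ z => inner_add_left _ _ _)
    (fun c y z => inner_smul_left _ _ _)
    (fun y z₁ z₂ => by rw [map_add, map_add, inner_add_right])
    (fun c y z => by rw [map_smul, map_smul, inner_smul_right]; rfl)
  have h : B' = B := sesquilin_ext fun y => by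
    change inner ℂ y (Iplus U (pencil U p 0 r μ y)) = inner ℂ (W21.deriv y) (mulLInf p (W21.deriv y)) +
      α * (conj ((y : W21) 1) * (y : W21) 1) - μ * r (W21.conjMul y y)
    rw [isPencil_pencil U p 0 r μ y, form, inner_mulLInf_self, hV, bdry_apply]
    simp [dotProduct, Fin.sum_univ_two, Matrix.mulVec_diagonal]
    ring
  exact LinearMap.congr_fun (LinearMap.congr_fun h z) y

/-! ### Coercivity and invertibility -/

theorem W21.norm_apply_le_apply_one (y : W21) (x : I) : ‖y x‖ ≤ ‖y 1‖ + 2 * ‖W21.deriv y‖ := by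
  have h : y x = y 1 + (∫ s in Icc 0 x, W21.deriv y s) - ∫ s in Icc 0 1, W21.deriv y s := by
    rw [y.eq_add_integral x, y.eq_add_integral 1]; ring
  have h2 := sobolevGraph.norm_integral_le (W21.deriv y) x
  have h3 := sobolevGraph.norm_integral_le (W21.deriv y) 1
  have h4 := norm_sub_le (y 1 + ∫ s in Icc 0 x, W21.deriv y s) (∫ s in Icc 0 1, W21.deriv y s)
  have h5 := norm_add_le (y 1) (∫ s in Icc 0 x, W21.deriv y s)
  rw [← h] at h4
  linarith

theorem le_integral_mul_norm_sq {p : LInf} {m : ℝ} (hp : ∀ᵐ x, m ≤ p x) (g : L2) :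
    m * ‖g‖ ^ 2 ≤ ∫ x, p x * ‖g x‖ ^ 2 := by
  have h1 : ‖g‖ ^ 2 = ∫ x, ‖g x‖ ^ 2 := by
    have h := MeasureTheory.L2.inner_def (𝕜 := ℂ) g g
    have h2 : inner ℂ g g = ((∫ x, ‖g x‖ ^ 2 : ℝ) : ℂ) := by
      rw [h]
      refine Eq.trans ?_ (integral_ofReal (𝕜 := ℂ))
      refine integral_congr_ae (Filter.Eventually.of_forall fun x => ?_)
      simp only [inner_self_eq_norm_sq_to_K]
      simp
    rw [← inner_self_eq_norm_sq (𝕜 := ℂ) g, h2]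
    rfl
  have hi : Integrable fun x => ‖g x‖ ^ 2 := (Lp.memLp g).integrable_norm_pow (by norm_num)
  rw [h1, ← integral_const_mul]
  refine integral_mono_ae (hi.const_mul m) ?_ ?_
  · have := hi.bdd_mul (c := ‖p‖) (Lp.aestronglyMeasurable p) (by
      filter_upwards [ae_le_eLpNormEssSup (f := p) (μ := (volume : Measure I))] with x hx
      rw [Lp.norm_def, eLpNorm_exponent_top]
      have := ENNReal.toReal_mono (by
        have := Lp.eLpNorm_ne_top p
        rwa [eLpNorm_exponent_top] at this) hx
      simpa using this)
    exact this
  · filter_upwards [hp] with x hx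
    exact mul_le_mul_of_nonneg_right hx (sq_nonneg _)

theorem AdmissibleDomain.coercive {H : Submodule ℂ W21} {α : ℝ} (hH : AdmissibleDomain H α)
    {p : LInf} (hp : UniformlyPositive p) : ∃ c : ℝ, 0 < c ∧ ∀ y ∈ H, c * ‖y‖ ^ 2 ≤
      (∫ x, p x * ‖W21.deriv y x‖ ^ 2) + α * ‖y 1‖ ^ 2 := by
  obtain ⟨m, hm, hpm⟩ := hp
  -- When `y 1 = 0` on the whole domain any positive `β` serves; this treats the three cases with
  -- one strictly positive coefficient.
  have hβ : ∃ β : ℝ, 0 < β ∧ ∀ y ∈ H, β * ‖y 1‖ ^ 2 = α * ‖y 1‖ ^ 2 := by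
    rcases hH with ⟨rfl, h⟩ | ⟨rfl, h⟩ | ⟨hα, h⟩
    · exact ⟨1, one_pos, fun y hy => by simp [((h y).1 hy).2]⟩
    · exact ⟨1, one_pos, fun y hy => by simp [(h y).1 hy]⟩
    · exact ⟨α, hα, fun y _ => rfl⟩
  obtain ⟨β, hβ0, hβ⟩ := hβ
  have hK : 0 < 9 / m + 2 / β := by positivity
  refine ⟨(9 / m + 2 / β)⁻¹, inv_pos.2 hK, fun y hy => ?_⟩
  rw [inv_mul_le_iff₀ hK, ← hβ y hy]
  have h1 := le_integral_mul_norm_sq hpm (W21.deriv y)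
  have h2 : ‖W21.toL2 y‖ ≤ ‖y 1‖ + 2 * ‖W21.deriv y‖ :=
    (W21.norm_toLp_le _).trans ((ContinuousMap.norm_le _ (by positivity)).2
      y.norm_apply_le_apply_one)
  -- Squaring `h2` gives `2 |y(1)|² + 8 ‖y'‖²`, and the norm of `W21` adds one more `‖y'‖²`.
  have h3 : ‖y‖ ^ 2 ≤ 9 * ‖W21.deriv y‖ ^ 2 + 2 * ‖y 1‖ ^ 2 := by
    rw [W21.norm_sq]
    have := pow_le_pow_left₀ (norm_nonneg _) h2 2
    nlinarith [sq_nonneg (‖y 1‖ - 2 * ‖W21.deriv y‖)]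
  refine h3.trans ?_
  have h4 : 9 * ‖W21.deriv y‖ ^ 2 ≤ 9 / m * ∫ x, p x * ‖W21.deriv y x‖ ^ 2 := by
    rw [div_mul_eq_mul_div, le_div_iff₀ hm]; linarith
  have h5 : 2 * ‖y 1‖ ^ 2 = 2 / β * (β * ‖y 1‖ ^ 2) := by field_simp
  have h6 : 0 ≤ ∫ x, p x * ‖W21.deriv y x‖ ^ 2 := le_trans (by positivity) h1
  have h7 : 0 ≤ 2 / β * ∫ x, p x * ‖W21.deriv y x‖ ^ 2 := by positivity
  have h8 : 0 ≤ 9 / m * (β * ‖y 1‖ ^ 2) := by positivity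
  linarith

/-- Lax–Milgram for `Iplus U ∘ T(0)`, transferred to `T(0)` because `Iplus U` is isometric. -/
theorem bijective_pencil_zero {U : Matrix (Fin 2) (Fin 2) ℂ} {α : ℝ}
    (hV : matV U = Matrix.diagonal ![0, (α : ℂ)]) (hH : AdmissibleDomain (HU U) α)
    {p : LInf} (hp : UniformlyPositive p) (r : Wm1) : Function.Bijective (pencil U p 0 r 0) := by
  obtain ⟨c, hc, h⟩ := hH.coercive hp
  have hu : IsUnit ((Iplus U).comp (pencil U p 0 r 0)) := by
    refine ContinuousLinearMap.isUnit_of_forall_le_norm_inner_map _ (c := c.toNNReal)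
      (Real.toNNReal_pos.2 hc) fun y => ?_
    rw [norm_inner_symm, ContinuousLinearMap.comp_apply, inner_pencil hV, zero_mul, sub_zero,
      inner_mulLInf_self, Complex.conj_mul', Real.coe_toNNReal _ hc.le, mul_comm]
    refine (h y y.2).trans (le_trans (le_of_eq ?_) (Complex.re_le_norm _))
    norm_cast
  have hb : Function.Bijective ((Iplus U) ∘ (pencil U p 0 r 0)) :=
    (ContinuousLinearMap.isUnit_iff_bijective).1 hu
  have hi : Function.Injective (Iplus U) :=
    (AddMonoidHomClass.isometry_of_norm (Iplus U) (norm_Iplus U)).injective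
  refine ⟨hb.1.of_comp, fun f => ?_⟩
  obtain ⟨y, hy⟩ := hb.2 (Iplus U f)
  exact ⟨y, hi hy⟩

/-! ### Counting sign changes -/

/-- There are `m` points before `τ` at which `Y` has alternating signs, the last sign being that
of `κ`. -/
inductive SignChain (Y : I → ℝ) : ℕ → ℝ → ℝ → Prop
  | nil (κ τ : ℝ) : SignChain Y 0 κ τ
  | cons {m : ℕ} {κ τ τ' : ℝ} (t : I) : SignChain Y m κ τ → τ < t → (t : ℝ) < τ' → 0 < t → t < 1 →
      0 < -κ * Y t → SignChain Y (m + 1) (-κ) τ'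

/-- The earliest point is the one dropped, so the last sign `κ` and the bound `τ` are kept. -/
theorem SignChain.of_succ {Y : I → ℝ} {m : ℕ} {κ τ : ℝ} (h : SignChain Y (m + 1) κ τ) :
    SignChain Y m κ τ := by
  generalize hk : m + 1 = k at h
  induction h generalizing m with
  | nil => omega
  | cons t h h1 h2 h3 h4 h5 ih =>
    rcases m with _ | m
    · exact .nil _ _
    · exact .cons t (ih (by omega)) h1 h2 h3 h4 h5

theorem SignChain.exists_points {Y : I → ℝ} {m : ℕ} {κ τ : ℝ} (h : SignChain Y m κ τ) :
    ∀ n, m = n + 1 → ∃ x : Fin (n + 1) → I, StrictMono x ∧ (∀ k, 0 < x k ∧ x k < 1) ∧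
      (∀ k : Fin n, Y (x k.castSucc) * Y (x k.succ) < 0) ∧ (x (Fin.last n) : ℝ) < τ ∧
      0 < κ * Y (x (Fin.last n)) := by
  induction h with
  | nil => intro n hn; omega
  | @cons m κ τ τ' t h h1 h2 h3 h4 h5 ih =>
    rintro n hn
    obtain rfl : m = n := by omega
    rcases m with _ | m
    · exact ⟨fun _ => t, fun i j hij => absurd hij (by omega), fun _ => ⟨h3, h4⟩, fun k => k.elim0, h2, h5⟩
    · obtain ⟨x, hx, hx1, hx2, hx3, hx4⟩ := ih m rfl
      refine ⟨Fin.snoc (α := fun _ => I) x t, ?_, ?_, ?_, by simpa using h2, by simpa using h5⟩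
      · rw [Fin.strictMono_iff_lt_succ]
        intro i
        refine Fin.lastCases ?_ (fun i => ?_) i
        · rw [Fin.succ_last, Fin.snoc_last, Fin.snoc_castSucc]
          exact_mod_cast hx3.trans h1
        · rw [Fin.succ_castSucc, Fin.snoc_castSucc, Fin.snoc_castSucc]
          exact hx i.castSucc_lt_succ
      · intro i
        refine Fin.lastCases ?_ (fun i => ?_) i
        · rw [Fin.snoc_last]; exact ⟨h3, h4⟩
        · rw [Fin.snoc_castSucc]; exact hx1 i
      · intro i
        refine Fin.lastCases ?_ (fun i => ?_) i
        · rw [Fin.succ_last, Fin.snoc_last, Fin.snoc_castSucc]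
          by_contra h0
          nlinarith [mul_pos hx4 h5, mul_nonneg (mul_self_nonneg κ) (not_lt.1 h0)]
        · rw [Fin.succ_castSucc, Fin.snoc_castSucc, Fin.snoc_castSucc]
          exact hx2 i

theorem SignChain.hasSignChanges {Y : I → ℝ} {n : ℕ} {κ τ : ℝ} (h : SignChain Y (n + 1) κ τ) :
    HasSignChanges Y n := by
  obtain ⟨x, hx, hx1, hx2, -⟩ := h.exists_points n rfl
  exact ⟨x, hx, hx1, hx2⟩

/-- If the increments of `V` are controlled by the signs of `Y` and those of `W` by the signs of
`V`, then, under suitable boundary conditions, `Y` has as many sign changes as `W` has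
pseudo-zeros. -/
theorem hasSignChanges_of_hasPseudoZeros {V : ℝ → ℝ} {W Y : I → ℝ}
    (hVY : ∀ κ a b : ℝ, 0 ≤ a → a < b → a < 1 → 0 < κ * (V b - V a) →
      ∃ t : I, a < t ∧ (t : ℝ) < b ∧ 0 < t ∧ t < 1 ∧ 0 < κ * Y t)
    (hWV : ∀ (κ : ℝ) (a b : I), a < b → κ * W b < κ * W a →
      ∃ τ : I, a < τ ∧ τ ≤ b ∧ κ * V τ < 0)
    (h0 : W 0 = 0 ∨ V 0 = 0) (h1 : W 1 = 0 ∨ ∃ α : ℝ, 0 < α ∧ V 2 = -α * W 1)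
    {n : ℕ} (hW : HasPseudoZeros W n) : HasSignChanges Y n := by
  obtain ⟨ε, hε, x, hx, hx01, hxε, hxt⟩ := hW
  -- If `κ V` passes from nonnegative to negative on the way from `τ` to `τ'`, then `V` moves in the
  -- direction `-κ`, so `Y` takes the sign `-κ` in between and the chain grows by one point.
  have step : ∀ {m : ℕ} {κ τ τ' : ℝ}, SignChain Y m κ τ → 0 ≤ τ → τ < 1 → τ < τ' →
      0 ≤ κ * V τ → κ * V τ' < 0 → SignChain Y (m + 1) (-κ) τ' := by
    intro m κ τ τ' h hτ0 hτ1 hττ' hV hV'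
    obtain ⟨t, ht1, ht2, ht3, ht4, ht5⟩ := hVY (-κ) τ τ' hτ0 hττ' hτ1 (by nlinarith)
    exact .cons t h ht1 ht2 ht3 ht4 ht5
  -- Invariant: `κ` is the sign of `W (x k)`, and by some `τ ≤ x k` with `κ V τ ≥ 0` the function
  -- `Y` has already shown `k` alternating signs, ending with that of `κ` if `k > 0`.
  have inv : ∀ k : Fin (n + 1), ∃ κ : ℝ, (κ = 1 ∨ κ = -1) ∧ ε < κ * W (x k) ∧
      ∃ τ : ℝ, 0 ≤ τ ∧ τ ≤ x k ∧ 0 ≤ κ * V τ ∧ SignChain Y k κ τ := by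
    intro k
    induction k using Fin.induction with
    | zero =>
      have hκ : ∃ κ : ℝ, (κ = 1 ∨ κ = -1) ∧ ε < κ * W (x 0) := by
        rcases lt_abs.1 (hxε 0) with h | h
        · exact ⟨1, Or.inl rfl, by linarith⟩
        · exact ⟨-1, Or.inr rfl, by linarith⟩
      obtain ⟨κ, hκ, hκW⟩ := hκ
      refine ⟨κ, hκ, hκW, ?_⟩
      rcases h0 with h0 | h0
      · obtain ⟨τ, h2, h3, h4⟩ := hWV (-κ) 0 (x 0) (hx01 0).1 (by rw [h0]; linarith)
        exact ⟨τ, τ.2.1, h3, by linarith, .nil _ _⟩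
      · exact ⟨0, le_rfl, (x 0).2.1, by rw [h0, mul_zero], .nil _ _⟩
    | succ k ih =>
      obtain ⟨κ, hκ, hκW, τ, hτ0, hτx, hτV, hτ⟩ := ih
      obtain ⟨t, ⟨ht1, ht2⟩, ht⟩ := hxt k
      have hxk1 : ((x k.castSucc : I) : ℝ) < 1 := (hx01 k.castSucc).2
      have hκt : κ * W t < ε ∧ -κ * W t < ε := by
        obtain ⟨h2, h3⟩ := abs_lt.1 ht
        rcases hκ with rfl | rfl <;> constructor <;> linarith
      have hκx : ε < κ * W (x k.succ) ∨ ε < -κ * W (x k.succ) := by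
        rcases hκ with rfl | rfl <;> rcases lt_abs.1 (hxε k.succ) with h | h <;>
          first | (left; linarith) | (right; linarith)
      rcases hκx with h | h
      -- Same sign at both points: `κ W` dips below `ε` at `t` and recovers, so `V` changes sign
      -- twice. The chain gains two points, and one is discarded to keep the parity of `κ`.
      · obtain ⟨τ₁, h2, h3, h4⟩ := hWV κ _ t ht1 (by linarith)
        obtain ⟨τ₂, h5, h6, h7⟩ := hWV (-κ) t _ ht2 (by linarith)
        have h2' : ((x k.castSucc : I) : ℝ) < τ₁ := h2
        have h8 : (τ₁ : ℝ) < τ₂ := lt_of_le_of_lt h3 h5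
        have h9 : (τ₂ : ℝ) ≤ 1 := τ₂.2.2
        have c1 := step hτ hτ0 (by linarith) (by linarith) hτV h4
        have c2 := step c1 τ₁.2.1 (by linarith) h8 (by linarith) h7
        rw [neg_neg] at c2
        refine ⟨κ, hκ, h, τ₂, τ₂.2.1, h6, by linarith, ?_⟩
        rw [Fin.val_succ]
        exact c2.of_succ
      -- Opposite signs: one descent of `κ W`, one new point, and `κ` flips.
      · obtain ⟨τ₁, h2, h3, h4⟩ := hWV κ _ _ (ht1.trans ht2) (by linarith)
        have h2' : ((x k.castSucc : I) : ℝ) < τ₁ := h2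
        have c1 := step hτ hτ0 (by linarith) (by linarith) hτV h4
        refine ⟨-κ, by rcases hκ with rfl | rfl <;> simp, h, τ₁, τ₁.2.1, h3, by linarith, ?_⟩
        rw [Fin.val_succ]
        exact c1
  obtain ⟨κ, hκ, hκW, τ, hτ0, hτx, hτV, hτ⟩ := inv (Fin.last n)
  have hxn1 : ((x (Fin.last n) : I) : ℝ) < 1 := (hx01 _).2
  -- The invariant at `x n` supplies only `n` points; the right boundary condition forces one
  -- further change of `V`, hence the point number `n + 1`.
  have hend : ∃ τ' : ℝ, τ < τ' ∧ κ * V τ' < 0 := by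
    by_cases h2 : κ * W 1 ≤ 0
    · obtain ⟨τ', h3, h4, h5⟩ := hWV κ _ 1 (hx01 (Fin.last n)).2 (by linarith)
      have h3' : ((x (Fin.last n) : I) : ℝ) < τ' := h3
      exact ⟨τ', by linarith, h5⟩
    · rcases h1 with h1 | ⟨α, hα, h1⟩
      · exact absurd (by rw [h1, mul_zero]) h2
      -- The argument `2` stands for the position just after `1`: in the application `V 1` does not
      -- yet include an atom at `1`, whereas `V 2` is the boundary value of the quasi-derivative.
      · refine ⟨2, by linarith, ?_⟩
        rw [h1]
        nlinarith [mul_pos hα (not_le.1 h2)]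
  obtain ⟨τ', h3, h4⟩ := hend
  exact (step hτ hτ0 (by linarith) h3 hτV (by linarith)).hasSignChanges

/-! ### The quasi-derivative -/

/-- The integral of `Y` over `[t,1]`. -/
noncomputable def tailIntegral (ρ : Measure I) (Y : I → ℝ) (t : ℝ) : ℝ :=
  ∫ s in {s : I | t ≤ s}, Y s ∂ρ

section tailIntegral

variable {ρ : Measure I} {Y : I → ℝ}

theorem measurableSet_le_coe (t : ℝ) : MeasurableSet {s : I | t ≤ s} :=
  measurableSet_le measurable_const measurable_subtype_coe

theorem tailIntegral_zero : tailIntegral ρ Y 0 = ∫ s, Y s ∂ρ := by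
  have h : {s : I | (0 : ℝ) ≤ s} = univ := eq_univ_of_forall fun s => s.2.1
  rw [tailIntegral, h, setIntegral_univ]

theorem tailIntegral_two : tailIntegral ρ Y 2 = 0 := by
  have h : {s : I | (2 : ℝ) ≤ s} = ∅ := eq_empty_of_forall_notMem fun s hs => by
    have h1 : (2 : ℝ) ≤ s := hs
    have h2 : (s : ℝ) ≤ 1 := s.2.2
    linarith
  rw [tailIntegral, h, setIntegral_empty]

theorem integral_indicator_eq_tailIntegral (g : I → ℂ) (t : I) :
    ∫ s, {z : I × I | z.2 ≤ z.1}.indicator (fun z => (Y z.1 : ℂ) * g z.2) (s, t) ∂ρ =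
      tailIntegral ρ Y t * g t := by
  have h : ∀ s, {z : I × I | z.2 ≤ z.1}.indicator (fun z => (Y z.1 : ℂ) * g z.2) (s, t) =
      ({s : I | (t : ℝ) ≤ s}.indicator (fun s => (Y s : ℂ)) s) * g t := by
    intro s
    by_cases hts : t ≤ s
    · rw [indicator_of_mem (show (s, t) ∈ {z : I × I | z.2 ≤ z.1} from hts),
        indicator_of_mem (show s ∈ {s : I | (t : ℝ) ≤ s} from hts)]
    · rw [indicator_of_notMem (show (s, t) ∉ {z : I × I | z.2 ≤ z.1} from hts),
        indicator_of_notMem (show s ∉ {s : I | (t : ℝ) ≤ s} from hts), zero_mul]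
  simp only [h]
  rw [integral_mul_const, integral_indicator (measurableSet_le_coe _), tailIntegral]
  congr 1
  exact integral_ofReal (𝕜 := ℂ)

variable [IsFiniteMeasure ρ]

theorem integrable_of_continuous_unitInterval {E : Type*} [NormedAddCommGroup E] {f : I → E}
    (hf : Continuous f) : Integrable f ρ :=
  hf.integrable_of_hasCompactSupport (HasCompactSupport.of_compactSpace _)

/-- The tail is closed at its left end, so increments are integrals over half-open sets `[a, b)`,
and an atom at `a` counts while one at `b` does not. -/
theorem tailIntegral_sub (hY : Continuous Y) {a b : ℝ} (hab : a ≤ b) :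
    tailIntegral ρ Y a - tailIntegral ρ Y b = ∫ s in {s : I | a ≤ s ∧ (s : ℝ) < b}, Y s ∂ρ := by
  have hi := integrable_of_continuous_unitInterval (ρ := ρ) hY
  have h : {s : I | a ≤ s ∧ (s : ℝ) < b} = {s : I | a ≤ s} \ {s : I | b ≤ s} := by
    ext s; simp
  have hsub : {s : I | b ≤ s} ⊆ {s : I | a ≤ s} := fun s hs => hab.trans hs
  rw [h, setIntegral_sdiff (measurableSet_le_coe b) hi.integrableOn hsub]
  rfl

/-- The integral provides a point of `[a, b)` in `[0, 1]` with the required sign, possibly an atom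
at an endpoint. By continuity of `Y` the sign persists nearby, which allows a move into the open
interval `(max a 0, min b 1)`. -/
theorem exists_pos_of_tailIntegral (hY : Continuous Y) {κ a b : ℝ} (hab : a < b) (ha : a < 1)
    (hb : 0 < b) (h : 0 < κ * (tailIntegral ρ Y a - tailIntegral ρ Y b)) :
    ∃ t : I, a < t ∧ (t : ℝ) < b ∧ 0 < t ∧ t < 1 ∧ 0 < κ * Y t := by
  obtain ⟨s, ⟨hs1, hs2⟩, hs⟩ : ∃ s : I, (a ≤ s ∧ (s : ℝ) < b) ∧ 0 < κ * Y s := by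
    by_contra! hc
    rw [tailIntegral_sub hY hab.le, ← integral_const_mul] at h
    refine absurd h (not_lt.2 (setIntegral_nonpos ?_ hc))
    exact (measurableSet_le_coe a).inter (measurableSet_lt measurable_subtype_coe measurable_const)
  have hlt : max a 0 < min b 1 := max_lt (lt_min hab ha) (lt_min hb one_pos)
  have hcl : (s : ℝ) ∈ closure (Ioo (max a 0) (min b 1)) := by
    rw [closure_Ioo hlt.ne]
    exact ⟨max_le hs1 s.2.1, le_min hs2.le s.2.2⟩
  have hop : IsOpen {t : ℝ | 0 < κ * IccExtend zero_le_one Y t} :=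
    isOpen_lt continuous_const (continuous_const.mul hY.Icc_extend')
  obtain ⟨t, ht, ht'⟩ := mem_closure_iff.1 hcl _ hop (by simpa using hs)
  have h1 := max_lt_iff.1 ht'.1
  have h2 := lt_min_iff.1 ht'.2
  refine ⟨⟨t, h1.2.le, h2.2.le⟩, h1.1, h2.1, h1.2, h2.2, ?_⟩
  have := IccExtend_of_mem zero_le_one Y (show t ∈ Icc (0 : ℝ) 1 from ⟨h1.2.le, h2.2.le⟩)
  rw [mem_ofPred_eq, this] at ht
  exact ht

theorem integrable_indicator_mul_prod {g : I → ℂ} (hg : Integrable g) (hY : Continuous Y) :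
    Integrable ({z : I × I | z.2 ≤ z.1}.indicator fun z => (Y z.1 : ℂ) * g z.2)
      (ρ.prod volume) := by
  have hY' : Integrable (fun s => (Y s : ℂ)) ρ := (integrable_of_continuous_unitInterval hY).ofReal
  exact (hY'.mul_prod hg).indicator (isClosed_le continuous_snd continuous_fst).measurableSet

/-- Fubini on the triangle `t ≤ s`: integration by parts against a measure that need not have a
density. -/
theorem integral_primitive_mul {g : I → ℂ} (hg : Integrable g) (hY : Continuous Y) :
    ∫ s, (Y s : ℂ) * (∫ t in Icc 0 s, g t) ∂ρ = ∫ t : I, (tailIntegral ρ Y t : ℂ) * g t := by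
  simp only [← integral_indicator_eq_tailIntegral]
  rw [← integral_integral_swap (f := fun s t => {z : I × I | z.2 ≤ z.1}.indicator
    (fun z => (Y z.1 : ℂ) * g z.2) (s, t)) (integrable_indicator_mul_prod hg hY)]
  refine integral_congr_ae (Filter.Eventually.of_forall fun s => ?_)
  simp only
  rw [← integral_const_mul, ← integral_indicator measurableSet_Icc]
  refine integral_congr_ae (Filter.Eventually.of_forall fun t => ?_)
  by_cases hts : t ≤ s
  · rw [indicator_of_mem (show t ∈ Icc 0 s from ⟨unitInterval.nonneg', hts⟩)]
    exact (indicator_of_mem (show (s, t) ∈ {z : I × I | z.2 ≤ z.1} from hts)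
      fun z => (Y z.1 : ℂ) * g z.2).symm
  · rw [indicator_of_notMem (fun h : t ∈ Icc 0 s => hts h.2)]
    exact (indicator_of_notMem (show (s, t) ∉ {z : I × I | z.2 ≤ z.1} from hts)
      fun z => (Y z.1 : ℂ) * g z.2).symm

theorem memLp_tailIntegral (hY : Continuous Y) :
    MemLp (fun t : I => (tailIntegral ρ Y t : ℂ)) 2 volume := by
  have h := (integrable_indicator_mul_prod (ρ := ρ) (integrable_const (1 : ℂ)) hY).integral_prod_right
  have h1 : AEStronglyMeasurable (fun t : I => (tailIntegral ρ Y t : ℂ)) volume := by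
    refine h.aestronglyMeasurable.congr (Filter.Eventually.of_forall fun t => ?_)
    exact (integral_indicator_eq_tailIntegral (fun _ => (1 : ℂ)) t).trans (mul_one _)
  refine MemLp.of_bound h1 (∫ s, ‖Y s‖ ∂ρ) (Filter.Eventually.of_forall fun t => ?_)
  rw [Complex.norm_real]
  refine (norm_integral_le_integral_norm _).trans ?_
  exact setIntegral_le_integral (integrable_of_continuous_unitInterval hY).norm
    (Filter.Eventually.of_forall fun s => norm_nonneg _)

end tailIntegral

/-! ### The weak equation and its boundary conditions -/

theorem inner_const_right (f : L2) (c : ℂ) :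
    inner ℂ f (Lp.const 2 (volume : Measure I) c) = c * conj (∫ t, f t) := by
  rw [MeasureTheory.L2.inner_def, ← integral_conj, ← integral_const_mul]
  refine integral_congr_ae ?_
  filter_upwards [Lp.coeFn_const (p := 2) (μ := (volume : Measure I)) c] with t ht
  rw [ht]
  simp

theorem integral_sub_const (h : L2) (c : ℂ) :
    ∫ t, (h - Lp.const 2 (volume : Measure I) c : L2) t = (∫ t, h t) - c := by
  have h1 : ∀ᵐ t, (h - Lp.const 2 (volume : Measure I) c : L2) t = h t - c := by
    filter_upwards [Lp.coeFn_sub h (Lp.const 2 (volume : Measure I) c),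
      Lp.coeFn_const (p := 2) (μ := (volume : Measure I)) c] with t h1 h2
    rw [h1, Pi.sub_apply, h2]
    rfl
  rw [integral_congr_ae h1, integral_sub (W21.integrable_L2 h) (integrable_const _)]
  simp

/-- A function orthogonal to all functions with zero mean is constant. -/
theorem eq_const_of_inner_eq_zero {h : L2}
    (H : ∀ f : L2, ∫ t, f t = 0 → inner ℂ f h = (0 : ℂ)) :
    h = Lp.const 2 (volume : Measure I) (∫ t, h t) := by
  have h1 : ∫ t, (h - Lp.const 2 (volume : Measure I) (∫ t, h t) : L2) t = 0 := by
    rw [integral_sub_const, sub_self]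
  rw [← sub_eq_zero, ← inner_self_eq_zero (𝕜 := ℂ), inner_sub_right, H _ h1, inner_const_right, h1,
    map_zero, mul_zero, sub_zero]

/-- The weak equation `-(p w')' + ρ y = 0` determines the quasi-derivative of `w`, up to a constant
which satisfies the natural boundary conditions. -/
theorem exists_mulLInf_deriv_eq {H : Submodule ℂ W21} {α : ℝ} (hH : AdmissibleDomain H α)
    {p : LInf} {ρ : Measure I} [IsFiniteMeasure ρ] {w : W21} {Y : I → ℝ} (hY : Continuous Y)
    (hw : ∀ z ∈ H, inner ℂ (W21.deriv z) (mulLInf p (W21.deriv w)) + α * (conj (z 1) * w 1) =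
      -∫ x, conj (z x) * (Y x : ℂ) ∂ρ) :
    ∃ c : ℂ, (∀ᵐ t : I, p t * W21.deriv w t = c - tailIntegral ρ Y t) ∧
      ∀ z ∈ H, c * conj (z 1 - z 0) + α * (conj (z 1) * w 1) +
        conj (z 0) * tailIntegral ρ Y 0 = 0 := by
  set G : L2 := (memLp_tailIntegral (ρ := ρ) hY).toLp _ with hG
  have hGt : ∀ᵐ t : I, G t = tailIntegral ρ Y t := MemLp.coeFn_toLp _
  -- Integration by parts turns the right side of the equation into a pairing with `z'` plus a
  -- boundary term at `0`.
  have hr : ∀ z : W21, ∫ x, conj (z x) * (Y x : ℂ) ∂ρ =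
      conj (z 0) * tailIntegral ρ Y 0 + inner ℂ (W21.deriv z) G := by
    intro z
    have hz : Integrable fun t => conj (W21.deriv z t) :=
      (W21.integrable_L2 (star (W21.deriv z))).congr (Lp.coeFn_star _)
    have h1 : inner ℂ (W21.deriv z) G =
        ∫ t : I, (tailIntegral ρ Y t : ℂ) * conj (W21.deriv z t) := by
      rw [MeasureTheory.L2.inner_def]
      refine integral_congr_ae ?_
      filter_upwards [hGt] with t ht
      rw [ht, RCLike.inner_apply]
    have h2 : ∀ x, conj (z x) * (Y x : ℂ) =
        conj (z 0) * (Y x : ℂ) + (Y x : ℂ) * ∫ t in Icc 0 x, conj (W21.deriv z t) := by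
      intro x
      rw [z.eq_add_integral x, integral_conj, map_add]; ring
    have hYc : Continuous fun x => (Y x : ℂ) := Complex.continuous_ofReal.comp hY
    have hi1 : Integrable (fun x => conj (z 0) * (Y x : ℂ)) ρ :=
      (integrable_of_continuous_unitInterval hYc).const_mul _
    have hi2 : Integrable (fun x => (Y x : ℂ) * ∫ t in Icc 0 x, conj (W21.deriv z t)) ρ := by
      refine integrable_of_continuous_unitInterval (hYc.mul ?_)
      simp only [integral_conj]
      exact Complex.continuous_conj.comp (W21.continuous_setIntegral_Icc _)
    rw [integral_congr_ae (Filter.Eventually.of_forall h2), integral_add hi1 hi2,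
      integral_primitive_mul hz hY, h1, integral_const_mul, tailIntegral_zero]
    congr 2
    exact integral_ofReal (𝕜 := ℂ)
  set h : L2 := mulLInf p (W21.deriv w) + G with hh
  have key : ∀ z ∈ H, inner ℂ (W21.deriv z) h + α * (conj (z 1) * w 1) +
      conj (z 0) * tailIntegral ρ Y 0 = 0 := by
    intro z hz
    rw [hh, inner_add_right]
    linear_combination hw z hz - hr z
  have hmem : ∀ z : W21, z 0 = 0 → z 1 = 0 → z ∈ H := by
    intro z h0 h1
    rcases hH with ⟨-, h⟩ | ⟨-, h⟩ | ⟨-, h⟩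
    · exact (h z).2 ⟨h0, h1⟩
    · exact (h z).2 h1
    · exact h z
  -- The du Bois-Reymond argument: every `f` with zero mean is the derivative of a function
  -- vanishing at both ends, which lies in `H` in all three cases. Hence `p w' + G` is constant.
  have hc : h = Lp.const 2 (volume : Measure I) (∫ t, h t) := by
    refine eq_const_of_inner_eq_zero fun f hf => ?_
    have h0 := W21.primitive_apply_zero 0 f
    have h1 := W21.primitive_apply_one 0 f
    rw [hf, add_zero] at h1
    have := key _ (hmem _ h0 h1)
    rw [h0, h1, W21.deriv_primitive] at this
    simpa using this
  refine ⟨∫ t, h t, ?_, fun z hz => ?_⟩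
  · have h3 : ∀ᵐ t, h t = ∫ t, h t := by
      have := Lp.coeFn_const (p := 2) (μ := (volume : Measure I)) (∫ t, h t)
      rw [← hc] at this
      exact this
    filter_upwards [h3, hGt, coeFn_mulLInf p (W21.deriv w),
      Lp.coeFn_add (mulLInf p (W21.deriv w)) G] with t h3 h4 h5 h6
    rw [← h3, ← hh.symm, h6, Pi.add_apply, h4, h5]
    ring
  · have h3 := key z hz
    rw [hc, inner_const_right] at h3
    rw [z.apply_one, add_sub_cancel_left, ← z.apply_one]
    exact h3

theorem W21.sub_eq_setIntegral (w : W21) {a b : I} (hab : a ≤ b) :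
    w b - w a = ∫ t in Ioc a b, W21.deriv w t := by
  have hi := W21.integrable_L2 (W21.deriv w)
  have h : Icc 0 b = Icc 0 a ∪ Ioc a b := (Icc_union_Ioc_eq_Icc unitInterval.nonneg' hab).symm
  have hd : Disjoint (Icc 0 a) (Ioc a b) :=
    disjoint_left.2 fun t h1 h2 => absurd h1.2 (not_le.2 h2.1)
  rw [w.eq_add_integral b, w.eq_add_integral a, h,
    setIntegral_union hd measurableSet_Ioc hi.integrableOn hi.integrableOn]
  ring

/-- This makes `c` real under Dirichlet conditions: there `Im w` vanishes at both ends, while its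
total increment is `Im c` times this integral. -/
theorem setIntegral_inv_ne_zero {p : LInf} (hp : UniformlyPositive p) :
    ∫ t in Ioc (0 : I) 1, (p t)⁻¹ ≠ 0 := by
  obtain ⟨m, hm, hpm⟩ := hp
  have hpm' : ∀ᵐ t ∂(volume.restrict (Ioc (0 : I) 1)), m ≤ p t := ae_restrict_of_ae hpm
  intro h0
  have hi : Integrable (fun t => (p t)⁻¹) (volume.restrict (Ioc (0 : I) 1)) := by
    refine Integrable.restrict (Integrable.of_bound
      (Lp.aestronglyMeasurable p).aemeasurable.inv.aestronglyMeasurable m⁻¹ ?_)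
    filter_upwards [hpm] with t ht
    rw [Pi.inv_apply, Real.norm_eq_abs, abs_of_pos (inv_pos.2 (hm.trans_le ht))]
    exact inv_anti₀ hm ht
  rw [integral_eq_zero_iff_of_nonneg_ae
    (by filter_upwards [hpm'] with t ht using inv_nonneg.2 (hm.le.trans ht)) hi] at h0
  have hf : ∀ᵐ _ : I ∂(volume.restrict (Ioc (0 : I) 1)), False := by
    filter_upwards [h0, hpm'] with t ht1 ht2
    exact (inv_pos.2 (hm.trans_le ht2)).ne' ht1
  rw [ae_iff] at hf
  simp at hf

/-- A solution of the weak equation `-(p w')' + ρ y = 0` with `y` real is real, and its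
quasi-derivative is given by the integrals of `y`. -/
theorem exists_quasiDeriv {H : Submodule ℂ W21} {α : ℝ} (hH : AdmissibleDomain H α)
    {p : LInf} (hp : UniformlyPositive p) {ρ : Measure I} [IsFiniteMeasure ρ] {w : W21}
    (hwH : w ∈ H) {Y : I → ℝ} (hY : Continuous Y)
    (hw : ∀ z ∈ H, inner ℂ (W21.deriv z) (mulLInf p (W21.deriv w)) + α * (conj (z 1) * w 1) =
      -∫ x, conj (z x) * (Y x : ℂ) ∂ρ) :
    W21.IsReal w ∧ ∃ c : ℝ,
      (∀ a b : I, a ≤ b → (w b).re - (w a).re = ∫ t in Ioc a b, (c - tailIntegral ρ Y t) / p t) ∧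
      ((w 0).re = 0 ∨ c - tailIntegral ρ Y 0 = 0) ∧
      ((w 1).re = 0 ∨ ∃ β : ℝ, 0 < β ∧ c = -β * (w 1).re) := by
  obtain ⟨c, hc, hnat⟩ := exists_mulLInf_deriv_eq hH hY hw
  have hd : ∀ᵐ t, W21.deriv w t = (c - tailIntegral ρ Y t) / p t := by
    obtain ⟨m, hm, hpm⟩ := hp
    filter_upwards [hc, hpm] with t ht hpt
    rw [← ht, mul_div_cancel_left₀]
    exact_mod_cast (hm.trans_le hpt).ne'
  have hi := W21.integrable_L2 (W21.deriv w)
  have hre : ∀ a b : I, a ≤ b →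
      (w b).re - (w a).re = ∫ t in Ioc a b, (c.re - tailIntegral ρ Y t) / p t := by
    intro a b hab
    rw [← Complex.sub_re, w.sub_eq_setIntegral hab]
    refine Eq.trans (integral_re (𝕜 := ℂ) hi.integrableOn).symm ?_
    refine integral_congr_ae (ae_restrict_of_ae ?_)
    filter_upwards [hd] with t ht
    rw [ht]
    simp [Complex.div_ofReal_re]
  have him : ∀ a b : I, a ≤ b →
      (w b).im - (w a).im = c.im * ∫ t in Ioc a b, (p t)⁻¹ := by
    intro a b hab
    rw [← Complex.sub_im, w.sub_eq_setIntegral hab, ← integral_const_mul]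
    refine Eq.trans (integral_im (𝕜 := ℂ) hi.integrableOn).symm ?_
    refine integral_congr_ae (ae_restrict_of_ae ?_)
    filter_upwards [hd] with t ht
    rw [ht]
    change ((c - tailIntegral ρ Y t) / p t : ℂ).im = _
    rw [Complex.div_ofReal_im, Complex.sub_im, Complex.ofReal_im, sub_zero, div_eq_mul_inv]
  -- The test function `1 - x` isolates the natural condition at `0`, the vanishing of the
  -- quasi-derivative there.
  have hnat0 : (∀ z, z 1 = 0 → z ∈ H) → c = tailIntegral ρ Y 0 := by
    intro h
    have h0 := W21.primitive_apply_zero 1 (Lp.const 2 (volume : Measure I) (-1 : ℂ))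
    have h1 : W21.primitive 1 (Lp.const 2 (volume : Measure I) (-1 : ℂ)) 1 = 0 := by
      rw [W21.primitive_apply_one, integral_congr_ae (Lp.coeFn_const (p := 2) (μ := (volume : Measure I)) (-1 : ℂ))]
      simp
    have := hnat _ (h _ h1)
    rw [h0, h1] at this
    simp only [zero_sub, map_neg, map_one, map_zero] at this
    linear_combination -this
  have hreal : c.im = 0 ∧ (w 1).im = 0 ∧ ((w 0).re = 0 ∨ c.re - tailIntegral ρ Y 0 = 0) ∧
      ((w 1).re = 0 ∨ ∃ β : ℝ, 0 < β ∧ c.re = -β * (w 1).re) := by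
    rcases hH with ⟨-, h⟩ | ⟨-, h⟩ | ⟨hα, h⟩
    · have h1 := (h w).1 hwH
      have h2 := him 0 1 zero_le_one
      rw [h1.1, h1.2] at h2
      have h3 : c.im * ∫ t in Ioc (0 : I) 1, (p t)⁻¹ = 0 := by rw [← h2]; simp
      refine ⟨(mul_eq_zero.1 h3).resolve_right (setIntegral_inv_ne_zero hp), ?_, Or.inl ?_,
        Or.inl ?_⟩ <;> simp [h1.1, h1.2]
    · have h1 := (h w).1 hwH
      have h2 := hnat0 fun z hz => (h z).2 hz
      refine ⟨?_, ?_, Or.inr ?_, Or.inl ?_⟩ <;> simp [h1, h2]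
    · have h2 := hnat0 fun z _ => h z
      -- Testing with the constant `1` gives the Robin condition `c = -α w(1)`; as `c` is real and
      -- `α ≠ 0`, so is `w(1)`.
      have h3 := hnat _ (h (W21.const 1))
      simp only [W21.const_apply, sub_self, map_zero, map_one, mul_zero, zero_add, one_mul] at h3
      rw [← h2] at h3
      have h4 : c = -α * w 1 := by linear_combination h3
      have h5 : c.im = 0 := by simp [h2]
      refine ⟨h5, ?_, Or.inr (by simp [h2]), Or.inr ⟨α, hα, by simp [h4]⟩⟩
      rw [h4] at h5
      simpa [hα.ne'] using h5
  obtain ⟨hcim, hw1, hb0, hb1⟩ := hreal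
  refine ⟨fun x => ?_, c.re, hre, hb0, hb1⟩
  have := him x 1 unitInterval.le_one'
  rw [hcim, zero_mul, hw1, zero_sub, neg_eq_zero] at this
  exact this

/-- Here the analysis meets the counting lemma, with `V t = c - tailIntegral ρ Y t`, where `Y` is
the real part of `y`. -/
theorem hasSignChanges_of_weak_solution {H : Submodule ℂ W21} {α : ℝ} (hH : AdmissibleDomain H α)
    {p : LInf} (hp : UniformlyPositive p) {r : Wm1} (hr : Nonneg r) {y w : W21}
    (hwH : w ∈ H) (hy : W21.IsReal y)
    (hw : ∀ z ∈ H, inner ℂ (W21.deriv z) (mulLInf p (W21.deriv w)) + α * (conj (z 1) * w 1) =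
      -r (W21.conjMul z y)) :
    W21.IsReal w ∧ ∀ n, HasPseudoZeros (fun x => (w x).re) n →
      HasSignChanges (fun x => (y x).re) n := by
  obtain ⟨ρ, _, hρ⟩ := hr.exists_measure
  have hyre : ∀ x, y x = ((y x).re : ℂ) := fun x => Complex.ext rfl (by simp [hy x])
  have hY : Continuous fun x => (y x).re := Complex.continuous_re.comp (W21.toC y).continuous
  obtain ⟨hwr, c, hc, h0, h1⟩ := exists_quasiDeriv (ρ := ρ) hH hp hwH hY fun z hz => by
    rw [hw z hz, hρ]
    congr 2
    funext x
    rw [W21.conjMul_apply, ← hyre]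
  refine ⟨hwr, fun n hn => hasSignChanges_of_hasPseudoZeros
    (V := fun t => c - tailIntegral ρ (fun x => (y x).re) t) ?_ ?_ h0 ?_ hn⟩
  · intro κ a b ha hab ha1 h
    refine exists_pos_of_tailIntegral (ρ := ρ) hY hab ha1 (ha.trans_lt hab) (lt_of_lt_of_eq h ?_)
    ring
  · intro κ a b hab h
    -- If `κ V ≥ 0` on all of `(a, b]`, then `κ w' = κ V / p ≥ 0` almost everywhere there, and `κ w`
    -- cannot decrease.
    by_contra! hcon
    have h2 : 0 ≤ ∫ t in Ioc a b, κ * ((c - tailIntegral ρ (fun x => (y x).re) t) / p t) := by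
      obtain ⟨m, hm, hpm⟩ := hp
      refine setIntegral_nonneg_of_ae_restrict ?_
      filter_upwards [ae_restrict_of_ae hpm, ae_restrict_mem measurableSet_Ioc] with t ht1 ht2
      rw [← mul_div_assoc]
      exact div_nonneg (hcon t ht2.1 ht2.2) (hm.le.trans ht1)
    rw [integral_const_mul, ← hc a b hab.le] at h2
    linarith
  · rw [tailIntegral_two, sub_zero]
    exact h1

theorem hasDerivAt_add_smul {F : Type*} [NormedAddCommGroup F] [NormedSpace ℂ F] (a b : F)
    (μ : ℂ) : HasDerivAt (fun μ : ℂ => a + μ • b) b μ := by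
  simpa using ((hasDerivAt_id μ).smul_const b).const_add a

end SturmLiouville

/-! ### The theorem -/

theorem mainTheorem3 (U : Matrix (Fin 2) (Fin 2) ℂ)
    (hU : U ∈ Matrix.unitaryGroup (Fin 2) ℂ) (hUd : U.IsDiag)
    (p : LInf) (hp : UniformlyPositive p)
    (r : Wm1) (hr : Nonneg r) (hrs : FullSupport r)
    (hBC :
      (∀ y0 y1 d0 d1 : ℂ, BoundaryCondition U y0 y1 d0 d1 ↔ y0 = 0 ∧ y1 = 0) ∨
      (∀ y0 y1 d0 d1 : ℂ, BoundaryCondition U y0 y1 d0 d1 ↔ d0 = 0 ∧ y1 = 0) ∨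
      (∃ C : ℝ, 0 < C ∧ ∀ y0 y1 d0 d1 : ℂ,
        BoundaryCondition U y0 y1 d0 d1 ↔ d0 = 0 ∧ d1 + C * y1 = 0)) :
    ∃ e : HU U ≃L[ℂ] HU' U,
      (e : HU U →L[ℂ] HU' U) = pencil U p 0 r 0 ∧
      ∀ μ : ℂ, ∃ T' : HU U →L[ℂ] HU' U,
        HasDerivAt (pencil U p 0 r) T' μ ∧
        StronglySignRegular ((e.symm : HU' U →L[ℂ] HU U).comp T') := by
  obtain ⟨α, hV, hH⟩ := exists_admissibleDomain hU hUd hBC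
  have hb := bijective_pencil_zero hV hH hp r
  have hi : Function.Injective (Iplus U) :=
    (AddMonoidHomClass.isometry_of_norm (Iplus U) (norm_Iplus U)).injective
  let e : HU U ≃L[ℂ] HU' U := ContinuousLinearEquiv.ofBijective (pencil U p 0 r 0)
    (LinearMap.ker_eq_bot.2 hb.1) (LinearMap.range_eq_top.2 hb.2)
  have he : (e : HU U →L[ℂ] HU' U) = pencil U p 0 r 0 :=
    ContinuousLinearEquiv.coe_ofBijective _ _ _
  have hpe : ∀ f, pencil U p 0 r 0 (e.symm f) = f := e.apply_symm_apply
  -- The pencil is affine in `μ`, so its derivative is the constant `T(1) - T(0)`, which represents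
  -- `-r`.
  have hlin : pencil U p 0 r =
      fun μ => pencil U p 0 r 0 + μ • (pencil U p 0 r 1 - pencil U p 0 r 0) := by
    funext μ
    refine ContinuousLinearMap.ext fun y => hi (ext_inner_left ℂ fun z => ?_)
    simp only [_root_.add_apply, _root_.smul_apply, _root_.sub_apply, map_add, map_smul, map_sub,
      inner_add_right, inner_smul_right, inner_sub_right, inner_pencil hV]
    ring
  refine ⟨e, he, fun μ => ⟨pencil U p 0 r 1 - pencil U p 0 r 0, ?_, ?_⟩⟩
  · have h := hasDerivAt_add_smul (pencil U p 0 r 0) (pencil U p 0 r 1 - pencil U p 0 r 0) μ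
    rwa [← hlin] at h
  -- Applying `T(0)` to `w = R y` and pairing with `z` gives exactly the weak equation with right
  -- side `-r (conjMul z y)`.
  · have key : ∀ y : HU U, W21.IsReal y → _ := fun y hy =>
      hasSignChanges_of_weak_solution hH hp hr (y := y)
        (w := (e.symm ((pencil U p 0 r 1 - pencil U p 0 r 0) y) : HU U)) (Subtype.prop _) hy
        fun z hz => by
          have h1 := inner_pencil hV p r 0 ⟨z, hz⟩
            (e.symm ((pencil U p 0 r 1 - pencil U p 0 r 0) y))
          rw [hpe, _root_.sub_apply, map_sub, inner_sub_right, inner_pencil hV,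
            inner_pencil hV] at h1
          linear_combination -h1
    exact ⟨fun y hy => (key y hy).1, fun n y hy => (key y hy).2 n⟩
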